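/- **Setting.** Let $d\ge 1$, and let $\mathbf x\sim\{\pm1\}^d$ be uniform. A function $f:\{\pm1\}^d\to\{0,1\}$ is *monotone* if in each coordinate it is either non-decreasing or non-increasing. The size of a decision tree is its number of leaves, $\mathrm{error}_f(T)=\Pr[T(\mathbf x)\ne f(\mathbf x)]$, and $\mathrm{opt}_s$ is the least error of a decision tree of size at most $s$. An *impurity function* is a concave $\mathscr G:[0,1]\to[0,1]$, symmetric around $\tfrac12$, with $\mathscr G(0)=\mathscr G(1)=0$ and $\mathscr G(\tfrac12)=1$. It is *$\kappa$-strongly concave* if $\frac{\mathscr G(a)+\mathscr G(b)}2\le \mathscr G(\frac{a+b}2)-\frac\kappa2(b-a)^2$, and *$(C,\alpha)$-Hölder* if $|\mathscr G(a)-\mathscr G(b)|\le C|a-b|^\alpha$, for all $a,b\in[0,1]$. All logarithms are to base 2. **Algorithm** $\mathrm{MiniBatchTopDown}_{\mathscr G}(t,b,S)$. For a leaf $\ell$ at depth $|\ell|$, a minibatch $B\sim\mathrm{Batch}_b(S,\ell)$ consists of $b$ examples chosen uniformly without replacement from the examples $(x,y)$ of $S$ such that $x$ reaches $\ell$ (of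 all these examples, if there are fewer than $b$). Put $D=\log t+\log\log t$ and start from the tree with a single leaf. While the tree has fewer than $t$ leaves: for each leaf $\ell$ of depth at most $D$ draw a fresh $B\sim\mathrm{Batch}_b(S,\ell)$, and for each coordinate $i$ compute $$2^{-|\ell|}\Big(\mathscr G(\mathbb E_B[y])-\tfrac12\mathscr G(\mathbb E_B[y\mid x_i=-1])-\tfrac12\mathscr G(\mathbb E_B[y\mid x_i=1])\Big)$$ (taken to be $0$ if all the examples in $B$ have the same value of $x_i$, or $B$ is empty); then split a leaf $\ell$ with a query to $x_i$, for a pair $(\ell,i)$ that maximizes this quantity, ties being broken by an arbitrary fixed rule (which may depend on the current tree and the set of maximizing pairs). Finally label each leaf $\ell$ with $\mathbf 1[\mathbb E_B[y]\ge\frac12]$ for a fresh $B\sim\mathrm{Batch}_b(S,\ell)$ (with $0$ if $B$ is empty). **Theorem.** There are absolute constants $c,K>0$ such that the following holds for all $d\ge 1$ and all $\kappa,C,\alpha>0$. Let $f:\{\pm1\}^d\to\{0,1\}$ be monotone and let $\mathscr G$ be a $\kappa$-strongly concave, $(C,\alpha)$-Hölder impurity function. Let $s\ge2$ be an integer, $\varepsilon,\delta\in(0,\frac12)$,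 and let $t,n,b$ be natural numbers with $$t\ \ge\ s^{\,c\log (s)/(\kappa\varepsilon^2)},\qquad b\ \ge\ K^{1/\alpha}\Big(\frac{C^2\log(s)^4}{\kappa^2\varepsilon^4}\Big)^{1/\alpha}\log\Big(\frac{td}{\delta}\Big),\qquad n\ \ge\ t\cdot K^{1/\alpha}\Big(\frac{C^2\log(s)^4}{\kappa^2\varepsilon^4}\Big)^{1/\alpha}\log\Big(\frac{td}{\delta}\Big)\log t .$$ Let $\mathbf S$ consist of $n$ independent labeled examples $(\mathbf x,f(\mathbf x))$. Then, with probability at least $1-\delta$ over $\mathbf S$ and the draws of minibatches, the tree $T$ output by $\mathrm{MiniBatchTopDown}_{\mathscr G}(t,b,\mathbf S)$ has size exactly $t$ and satisfies $\mathrm{error}_f(T)\le\mathrm{opt}_s+\varepsilon$. -/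

import Mathlib

section

open scoped Classical

/-- The cube `{±1}^d`: the bit `true` stands for `+1` and `false` for `-1`. -/
abbrev Cube (d : ℕ) : Type := Fin d → Bool

/-- `f` is monotone: in every coordinate it is either non-decreasing or non-increasing
(the direction may depend on the coordinate). -/
def IsMonotone {d : ℕ} (f : Cube d → Bool) : Prop :=
  ∀ i : Fin d,
    (∀ x : Cube d, f (Function.update x i false) ≤ f (Function.update x i true)) ∨
    (∀ x : Cube d, f (Function.update x i true) ≤ f (Function.update x i false))

/-- Impurity functions `G : [0,1] → [0,1]`; only the values of `G` on `[0,1]` matter. -/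
structure IsImpurity (G : ℝ → ℝ) : Prop where
  mapsTo : Set.MapsTo G (Set.Icc 0 1) (Set.Icc 0 1)
  concave : ConcaveOn ℝ (Set.Icc 0 1) G
  symmetric : ∀ p ∈ Set.Icc (0 : ℝ) 1, G (1 - p) = G p
  map_zero : G 0 = 0
  map_one : G 1 = 0
  map_half : G (1 / 2) = 1

/-- `(C, α)`-Hölder continuity on `[0,1]`. -/
def IsHolder (C α : ℝ) (G : ℝ → ℝ) : Prop :=
  ∀ a ∈ Set.Icc (0 : ℝ) 1, ∀ b ∈ Set.Icc (0 : ℝ) 1, |G a - G b| ≤ C * |a - b| ^ α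

/-- `κ`-strong concavity on `[0,1]` (midpoint form). -/
def IsStronglyConcave (κ : ℝ) (G : ℝ → ℝ) : Prop :=
  ∀ a ∈ Set.Icc (0 : ℝ) 1, ∀ b ∈ Set.Icc (0 : ℝ) 1,
    (G a + G b) / 2 ≤ G ((a + b) / 2) - κ / 2 * (b - a) ^ 2

/-- Binary decision trees over the attributes `x_i`, with leaves labelled by `L`.
At `node i lo hi` the inputs with `x_i = -1` go to `lo`, those with `x_i = +1` to `hi`. -/
inductive DecisionTree (d : ℕ) (L : Type) : Type
  | leaf (a : L) : DecisionTree d L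
  | node (i : Fin d) (lo hi : DecisionTree d L) : DecisionTree d L

/-- Partial (or bare) trees: the leaves carry no label. -/
abbrev PartialTree (d : ℕ) : Type := DecisionTree d Unit

/-- A leaf of a partial tree, given by the root-to-leaf path: the attributes queried and the
answers. The depth of the leaf is the length of the path. -/
abbrev Leaf (d : ℕ) : Type := List (Fin d × Bool)

/-- `x` is consistent with the leaf `ℓ`. -/
def Consistent {d : ℕ} (ℓ : Leaf d) (x : Cube d) : Prop := ∀ q ∈ ℓ, x q.1 = q.2

namespace DecisionTree

variable {d : ℕ}

/-- The size of a tree is its number of leaves. -/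
def size {L : Type} : DecisionTree d L → ℕ
  | leaf _ => 1
  | node _ lo hi => lo.size + hi.size

/-- The Boolean function computed by a tree with labelled leaves. -/
def eval : DecisionTree d Bool → Cube d → Bool
  | leaf a, _ => a
  | node i lo hi, x => if x i = true then hi.eval x else lo.eval x

/-- The set of leaves of a partial tree. -/
def leaves : PartialTree d → Finset (Leaf d)
  | leaf _ => {[]}
  | node i lo hi =>
      lo.leaves.image (fun p => (i, false) :: p) ∪ hi.leaves.image (fun p => (i, true) :: p)

/-- `T.split ℓ j` replaces the leaf `ℓ` of `T` by a query to `x_j` with two new leaves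
(and changes nothing if `ℓ` is not a leaf of `T`). -/
def split : PartialTree d → Leaf d → Fin d → PartialTree d
  | leaf _, [], j => node j (leaf ()) (leaf ())
  | leaf u, _ :: _, _ => leaf u
  | node i lo hi, [], _ => node i lo hi
  | node i lo hi, (k, v) :: p, j =>
      if k = i then
        (if v = true then node i lo (hi.split p j) else node i (lo.split p j) hi)
      else node i lo hi

/-- Label every leaf `ℓ` of a partial tree with `lab ℓ`. -/
def complete : PartialTree d → (Leaf d → Bool) → DecisionTree d Bool
  | leaf _, lab => leaf (lab [])
  | node i lo hi, lab =>
      node i (lo.complete fun p => lab ((i, false) :: p))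
        (hi.complete fun p => lab ((i, true) :: p))

end DecisionTree

/-- `error_f(T) = Pr[f(x) ≠ T(x)]` for uniform `x`. -/
noncomputable def treeError {d : ℕ} (f : Cube d → Bool) (T : DecisionTree d Bool) : ℝ :=
  ((Finset.univ.filter fun x : Cube d => f x ≠ T.eval x).card : ℝ) / 2 ^ d

/-- `opt_s(f)`: the least error of a decision tree with at most `s` leaves. -/
noncomputable def optError {d : ℕ} (f : Cube d → Bool) (s : ℕ) : ℝ :=
  sInf {e : ℝ | ∃ T : DecisionTree d Bool, T.size ≤ s ∧ treeError f T = e}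

/-- A labelled dataset with `n` examples `(x, y)`; repetitions are allowed. -/
abbrev Dataset (d n : ℕ) : Type := Fin n → Cube d × Bool

/-- `n` independent uniform examples, labelled by `f`. -/
noncomputable def sampleDist {d : ℕ} (f : Cube d → Bool) (n : ℕ) : PMF (Dataset d n) :=
  (PMF.uniformOfFintype (Fin n → Cube d)).map fun x k => (x k, f (x k))

section Algorithm

variable {d n : ℕ}

/-- The (indices of the) examples of `S` consistent with the leaf `ℓ`. -/
noncomputable def consistentExamples (S : Dataset d n) (ℓ : Leaf d) : Finset (Fin n) :=
  Finset.univ.filter fun k => Consistent ℓ (S k).1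

/-- The possible minibatches consistent with `ℓ`: all sets of `b` examples consistent with `ℓ`
(just the set of all of them, if there are fewer than `b`). -/
noncomputable def batches (S : Dataset d n) (b : ℕ) (ℓ : Leaf d) : Finset (Finset (Fin n)) :=
  (consistentExamples S ℓ).powersetCard (min b (consistentExamples S ℓ).card)

theorem batches_nonempty (S : Dataset d n) (b : ℕ) (ℓ : Leaf d) : (batches S b ℓ).Nonempty :=
  Finset.powersetCard_nonempty.2 (min_le_right _ _)

/-- Independent minibatches `B ∼ Batch_b(S, ℓ)`, one for every leaf `ℓ` in `A`: the uniform
distribution on the product of the sets of possible minibatches. -/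
noncomputable def drawBatches (S : Dataset d n) (b : ℕ) (A : Finset (Leaf d)) :
    PMF ({ℓ : Leaf d // ℓ ∈ A} → Finset (Fin n)) :=
  PMF.uniformOfFinset (Fintype.piFinset fun ℓ : {ℓ : Leaf d // ℓ ∈ A} => batches S b ℓ.1)
    (Fintype.piFinset_nonempty.2 fun ℓ => batches_nonempty S b ℓ.1)

/-- The average label over a batch (`0` for the empty batch). -/
noncomputable def meanLabel (S : Dataset d n) (B : Finset (Fin n)) : ℝ :=
  (∑ k ∈ B, if (S k).2 = true then (1 : ℝ) else 0) / (B.card : ℝ)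

/-- The examples of a batch with `x_i = v`. -/
def side (S : Dataset d n) (B : Finset (Fin n)) (i : Fin d) (v : Bool) : Finset (Fin n) :=
  B.filter fun k => (S k).1 i = v

/-- The local gain of a query to `x_i`, estimated from a batch. A query that does not divide the
batch (one of the two conditional expectations is over the empty set) has gain `0`. -/
noncomputable def localGain (G : ℝ → ℝ) (S : Dataset d n) (B : Finset (Fin n)) (i : Fin d) : ℝ :=
  if (side S B i false).Nonempty ∧ (side S B i true).Nonempty then
    G (meanLabel S B) -
      (1 / 2 * G (meanLabel S (side S B i false)) + 1 / 2 * G (meanLabel S (side S B i true)))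
  else 0

/-- The purity gain of a query to `x_i` at the leaf `ℓ`, estimated from a batch. -/
noncomputable def purityGain (G : ℝ → ℝ) (S : Dataset d n) (ℓ : Leaf d) (B : Finset (Fin n))
    (i : Fin d) : ℝ :=
  (1 / 2) ^ ℓ.length * localGain G S B i

/-- The pairs `(ℓ, i)`, with `ℓ` in `A` and `i` any coordinate, of maximal estimated purity gain. -/
noncomputable def maximizers (G : ℝ → ℝ) (S : Dataset d n) (A : Finset (Leaf d))
    (B : {ℓ : Leaf d // ℓ ∈ A} → Finset (Fin n)) : Finset (Leaf d × Fin d) :=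
  (Finset.univ.filter fun p : {ℓ : Leaf d // ℓ ∈ A} × Fin d =>
      ∀ q : {ℓ : Leaf d // ℓ ∈ A} × Fin d,
        purityGain G S q.1.1 (B q.1) q.2 ≤ purityGain G S p.1.1 (B p.1) p.2).image
    fun p => (p.1.1, p.2)

/-- The depth bound `D = log t + log log t`. -/
noncomputable def depthBound (t : ℕ) : ℝ :=
  Real.logb 2 t + Real.logb 2 (Real.logb 2 t)

/-- The leaves of `T` of depth at most `D`. -/
noncomputable def splittableLeaves (t : ℕ) (T : PartialTree d) : Finset (Leaf d) :=
  T.leaves.filter fun ℓ => (ℓ.length : ℝ) ≤ depthBound t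

/-- One iteration of the loop: draw fresh minibatches for all leaves of depth at most `D`, score
all pairs, and split at a pair of maximal score; `tie` picks one if there are several.
(If there is no pair to choose from, the tree is left as it is.) -/
noncomputable def growStep (G : ℝ → ℝ) (tie : PartialTree d → Finset (Leaf d × Fin d) → Leaf d × Fin d)
    (t b : ℕ) (S : Dataset d n) (T : PartialTree d) : PMF (PartialTree d) :=
  (drawBatches S b (splittableLeaves t T)).map fun B =>
    if (maximizers G S (splittableLeaves t T) B).Nonempty then
      T.split (tie T (maximizers G S (splittableLeaves t T) B)).1
        (tie T (maximizers G S (splittableLeaves t T) B)).2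
    else T

/-- The loop `while (size T < t)`, with at most `k` iterations. -/
noncomputable def growLoop (G : ℝ → ℝ)
    (tie : PartialTree d → Finset (Leaf d × Fin d) → Leaf d × Fin d)
    (t b : ℕ) (S : Dataset d n) : ℕ → PartialTree d → PMF (PartialTree d)
  | 0, T => PMF.pure T
  | k + 1, T =>
      if T.size < t then (growStep G tie t b S T).bind (growLoop G tie t b S k) else PMF.pure T

/-- The minibatch completion of a partial tree: every leaf is labelled with the rounded average
`1[mean ≥ 1/2]` of the labels in a fresh minibatch consistent with it. -/
noncomputable def batchCompletion (b : ℕ) (S : Dataset d n) (T : PartialTree d) :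
    PMF (DecisionTree d Bool) :=
  (drawBatches S b T.leaves).map fun B =>
    T.complete fun ℓ => if h : ℓ ∈ T.leaves then decide (1 / 2 ≤ meanLabel S (B ⟨ℓ, h⟩)) else false

/-- `MiniBatchTopDown_G(t, b, S)`, with ties broken by `tie`: the distribution of the output over
the draws of minibatches. Every iteration adds one leaf to the tree, so `t` iterations are enough
for the loop to end. -/
noncomputable def miniBatchTopDown (G : ℝ → ℝ)
    (tie : PartialTree d → Finset (Leaf d × Fin d) → Leaf d × Fin d)
    (t b : ℕ) (S : Dataset d n) : PMF (DecisionTree d Bool) :=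
  (growLoop G tie t b S t (DecisionTree.leaf ())).bind (batchCompletion b S)

end Algorithm

end

section

open scoped Classical

variable {d : ℕ}

/-- The real value of a bit. -/
noncomputable def bitVal (b : Bool) : ℝ := if b = true then 1 else 0

theorem bitVal_nonneg (b : Bool) : 0 ≤ bitVal b := by unfold bitVal; split_ifs <;> norm_num

theorem bitVal_le_one (b : Bool) : bitVal b ≤ 1 := by unfold bitVal; split_ifs <;> norm_num

/-- The expectation of `g` over the uniform distribution on the cube. -/
noncomputable def cubeAvg (g : Cube d → ℝ) : ℝ := (∑ x, g x) / 2 ^ d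

theorem cubeAvg_mono {g h : Cube d → ℝ} (H : ∀ x, g x ≤ h x) : cubeAvg g ≤ cubeAvg h := by
  unfold cubeAvg
  gcongr with x
  exact H x

theorem cubeAvg_add (g h : Cube d → ℝ) :
    cubeAvg (fun x => g x + h x) = cubeAvg g + cubeAvg h := by
  simp [cubeAvg, Finset.sum_add_distrib, add_div]

theorem cubeAvg_sub (g h : Cube d → ℝ) :
    cubeAvg (fun x => g x - h x) = cubeAvg g - cubeAvg h := by
  simp [cubeAvg, Finset.sum_sub_distrib, sub_div]

theorem cubeAvg_const_mul (c : ℝ) (g : Cube d → ℝ) :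
    cubeAvg (fun x => c * g x) = c * cubeAvg g := by
  simp [cubeAvg, ← Finset.mul_sum, mul_div_assoc]

theorem cubeAvg_const (c : ℝ) : cubeAvg (fun _ : Cube d => c) = c := by
  simp [cubeAvg]

theorem cubeAvg_sum {ι : Type*} (s : Finset ι) (g : ι → Cube d → ℝ) :
    cubeAvg (fun x => ∑ k ∈ s, g k x) = ∑ k ∈ s, cubeAvg (g k) := by
  simp only [cubeAvg]
  rw [Finset.sum_comm, Finset.sum_div]

theorem abs_cubeAvg_le (g : Cube d → ℝ) : |cubeAvg g| ≤ cubeAvg fun x => |g x| := by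
  unfold cubeAvg
  rw [abs_div, abs_of_pos (by positivity : (0 : ℝ) < 2 ^ d)]
  gcongr
  exact Finset.abs_sum_le_sum_abs _ _

theorem cubeAvg_nonneg {g : Cube d → ℝ} (H : ∀ x, 0 ≤ g x) : 0 ≤ cubeAvg g := by
  simpa [cubeAvg_const] using cubeAvg_mono (g := fun _ => 0) H

theorem cubeAvg_le_one {g : Cube d → ℝ} (H : ∀ x, g x ≤ 1) : cubeAvg g ≤ 1 := by
  simpa [cubeAvg_const] using cubeAvg_mono (h := fun _ => 1) H

/-- The restriction of `g` to `x_i = v`. -/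
def fixCoord {β : Type*} (i : Fin d) (v : Bool) (g : Cube d → β) : Cube d → β :=
  fun x => g (Function.update x i v)

theorem cubeAvg_eq_half (i : Fin d) (g : Cube d → ℝ) :
    cubeAvg g = (cubeAvg (fixCoord i false g) + cubeAvg (fixCoord i true g)) / 2 := by
  have hinv : Function.Involutive fun x : Cube d => Function.update x i (!x i) := by
    intro x; simp
  have h1 : ∑ x, g (Function.update x i (!x i)) = ∑ x, g x :=
    Equiv.sum_comp hinv.toPerm g
  have h2 : ∀ x : Cube d, g x + g (Function.update x i (!x i)) =
      fixCoord i false g x + fixCoord i true g x := by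
    intro x
    unfold fixCoord
    have hx : Function.update x i (x i) = x := Function.update_eq_self i x
    cases h : x i
    · rw [h] at hx; simp [hx]
    · rw [h] at hx; simp [hx, add_comm]
  have h3 := Finset.sum_congr (rfl : (Finset.univ : Finset (Cube d)) = _) fun x _ => h2 x
  rw [Finset.sum_add_distrib, Finset.sum_add_distrib, h1] at h3
  unfold cubeAvg
  field_simp
  linarith

theorem cubeAvg_indicator_coord (i : Fin d) (v : Bool) (g : Cube d → ℝ) :
    cubeAvg (fun x => if x i = v then g x else 0) = cubeAvg (fixCoord i v g) / 2 := by
  rw [cubeAvg_eq_half i]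
  unfold fixCoord
  cases v <;> simp [cubeAvg_const]

/-- The influence of `x_i` on `g`. -/
noncomputable def influence (i : Fin d) (g : Cube d → ℝ) : ℝ :=
  cubeAvg fun x => |fixCoord i true g x - fixCoord i false g x|

theorem cubeAvg_abs_fixCoord_sub (i : Fin d) (v : Bool) (g : Cube d → ℝ) :
    cubeAvg (fun x => |fixCoord i v g x - g x|) = influence i g / 2 := by
  rw [cubeAvg_eq_half i, influence]
  unfold fixCoord
  cases v <;> simp [cubeAvg_const, abs_sub_comm]

namespace DecisionTree

variable {L : Type}

/-- The restriction of a decision tree to `x_i = v`. -/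
def restrict (i : Fin d) (v : Bool) : DecisionTree d L → DecisionTree d L
  | leaf a => leaf a
  | node j lo hi =>
      if j = i then (if v = true then hi.restrict i v else lo.restrict i v)
      else node j (lo.restrict i v) (hi.restrict i v)

theorem size_pos : ∀ T : DecisionTree d L, 0 < T.size
  | leaf _ => Nat.one_pos
  | node _ lo _ => Nat.add_pos_left lo.size_pos _

theorem size_restrict_le (i : Fin d) (v : Bool) :
    ∀ T : DecisionTree d L, (T.restrict i v).size ≤ T.size
  | leaf _ => le_rfl
  | node j lo hi => by
      have h1 := lo.size_restrict_le i v
      have h2 := hi.size_restrict_le i v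
      unfold restrict
      split_ifs <;> simp only [size] <;> omega

theorem eval_restrict (i : Fin d) (v : Bool) (x : Cube d) :
    ∀ T : DecisionTree d Bool, (T.restrict i v).eval x = T.eval (Function.update x i v)
  | leaf _ => rfl
  | node j lo hi => by
      have h1 := lo.eval_restrict i v x
      have h2 := hi.eval_restrict i v x
      unfold restrict
      by_cases hj : j = i
      · subst hj
        cases v <;> simp [eval, h1, h2]
      · simp [eval, h1, h2, hj]

end DecisionTree

theorem logb_add_ge_average {a b : ℝ} (ha : 0 < a) (hb : 0 < b) :
    1 + (Real.logb 2 a + Real.logb 2 b) / 2 ≤ Real.logb 2 (a + b) := by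
  have h4 : Real.logb 2 4 = 2 := by
    rw [show (4 : ℝ) = 2 ^ (2 : ℝ) by norm_num, Real.logb_rpow] <;> norm_num
  have h : Real.logb 2 (4 * (a * b)) ≤ Real.logb 2 ((a + b) ^ 2) := by
    apply Real.logb_le_logb_of_le (by norm_num) (by positivity)
    nlinarith [sq_nonneg (a - b)]
  rw [Real.logb_mul (by norm_num) (by positivity), Real.logb_mul ha.ne' hb.ne', h4,
    Real.logb_pow] at h
  push_cast at h
  linarith

/-- The two-function OSSS inequality, for a decision tree and a function of small influences. -/
theorem abs_cov_le_of_influence_le {M : ℝ} (F : Cube d → ℝ) (hM : ∀ i, influence i F ≤ M) :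
    ∀ (N : ℕ) (T : DecisionTree d Bool), T.size ≤ N →
      |cubeAvg (fun x => bitVal (T.eval x) * F x) - cubeAvg (fun x => bitVal (T.eval x)) * cubeAvg F|
        ≤ M / 2 * Real.logb 2 T.size := by
  intro N
  induction N with
  | zero => intro T hT; exact absurd T.size_pos (by omega)
  | succ N ih =>
    intro T hT
    match T with
    | .leaf a =>
      simp [DecisionTree.eval, DecisionTree.size, cubeAvg_const_mul, cubeAvg_const]
    | .node i lo hi =>
      have hM0 : 0 ≤ M := (cubeAvg_nonneg fun x => abs_nonneg _).trans (hM i)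
      have hlo := lo.size_pos
      have hhi := hi.size_pos
      simp only [DecisionTree.size] at hT ⊢
      have key : ∀ (v : Bool) (U : DecisionTree d Bool), U.size ≤ N →
          |cubeAvg (fun x => bitVal ((U.restrict i v).eval x) * fixCoord i v F x) -
            cubeAvg (fun x => bitVal ((U.restrict i v).eval x)) * cubeAvg F|
            ≤ M / 2 * (1 + Real.logb 2 U.size) := by
        intro v U hU
        have hs := U.size_restrict_le i v
        have h1 := ih (U.restrict i v) (hs.trans hU)
        have h2 : Real.logb 2 (U.restrict i v).size ≤ Real.logb 2 U.size := by
          apply Real.logb_le_logb_of_le (by norm_num)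
          · exact_mod_cast DecisionTree.size_pos _
          · exact_mod_cast hs
        have h3 : |cubeAvg (fun x => bitVal ((U.restrict i v).eval x) * fixCoord i v F x) -
            cubeAvg (fun x => bitVal ((U.restrict i v).eval x) * F x)| ≤ M / 2 := by
          rw [← cubeAvg_sub]
          refine (abs_cubeAvg_le _).trans ?_
          calc _ ≤ cubeAvg (fun x => |fixCoord i v F x - F x|) := by
                apply cubeAvg_mono
                intro x
                rw [← mul_sub, abs_mul, abs_of_nonneg (bitVal_nonneg _)]
                exact mul_le_of_le_one_left (abs_nonneg _) (bitVal_le_one _)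
            _ ≤ M / 2 := by
                rw [cubeAvg_abs_fixCoord_sub]
                linarith [hM i]
        have h4 : M / 2 * Real.logb 2 (U.restrict i v).size ≤ M / 2 * Real.logb 2 U.size := by
          gcongr
        have := abs_sub_le (cubeAvg (fun x => bitVal ((U.restrict i v).eval x) * fixCoord i v F x))
          (cubeAvg (fun x => bitVal ((U.restrict i v).eval x) * F x))
          (cubeAvg (fun x => bitVal ((U.restrict i v).eval x)) * cubeAvg F)
        linarith
      have k0 := key false lo (by omega)
      have k1 := key true hi (by omega)
      have e0 : ∀ x, fixCoord i false (fun x => bitVal ((DecisionTree.node i lo hi).eval x)) x =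
          bitVal ((lo.restrict i false).eval x) := by
        intro x; simp [fixCoord, DecisionTree.eval, DecisionTree.eval_restrict]
      have e1 : ∀ x, fixCoord i true (fun x => bitVal ((DecisionTree.node i lo hi).eval x)) x =
          bitVal ((hi.restrict i true).eval x) := by
        intro x; simp [fixCoord, DecisionTree.eval, DecisionTree.eval_restrict]
      have a1 := cubeAvg_eq_half i fun x => bitVal ((DecisionTree.node i lo hi).eval x) * F x
      have a2 := cubeAvg_eq_half i fun x => bitVal ((DecisionTree.node i lo hi).eval x)
      rw [funext e0, funext e1] at a2
      have m0 : fixCoord i false (fun x => bitVal ((DecisionTree.node i lo hi).eval x) * F x) =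
          fun x => bitVal ((lo.restrict i false).eval x) * fixCoord i false F x := by
        funext x; rw [← e0]; rfl
      have m1 : fixCoord i true (fun x => bitVal ((DecisionTree.node i lo hi).eval x) * F x) =
          fun x => bitVal ((hi.restrict i true).eval x) * fixCoord i true F x := by
        funext x; rw [← e1]; rfl
      rw [m0, m1] at a1
      rw [a1, a2]
      have hlog := logb_add_ge_average (a := lo.size) (b := hi.size) (by exact_mod_cast hlo)
        (by exact_mod_cast hhi)
      have hfin := mul_le_mul_of_nonneg_left hlog (by linarith : 0 ≤ M / 2)
      push_cast
      rw [abs_le] at k0 k1 ⊢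
      constructor <;> nlinarith [k0.1, k0.2, k1.1, k1.2]

/-- A function without influential variables cannot be approximated by a small decision tree much
better than by a constant. -/
theorem min_cubeAvg_le_of_influence_le {M : ℝ} (f : Cube d → Bool)
    (hM : ∀ i, influence i (fun x => bitVal (f x)) ≤ M) (hM0 : 0 ≤ M) (T : DecisionTree d Bool)
    {s : ℕ} (hs : T.size ≤ s) :
    min (cubeAvg fun x => bitVal (f x)) (1 - cubeAvg fun x => bitVal (f x)) ≤
      cubeAvg (fun x => if f x ≠ T.eval x then 1 else 0) + M * Real.logb 2 s := by
  have h := abs_cov_le_of_influence_le (fun x => bitVal (f x)) hM _ T le_rfl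
  have hlog : M * Real.logb 2 T.size ≤ M * Real.logb 2 s := by
    refine mul_le_mul_of_nonneg_left (Real.logb_le_logb_of_le (by norm_num) ?_ ?_) hM0
    · exact_mod_cast T.size_pos
    · exact_mod_cast hs
  have e : cubeAvg (fun x => if f x ≠ T.eval x then (1 : ℝ) else 0) =
      cubeAvg (fun x => bitVal (f x)) + cubeAvg (fun x => bitVal (T.eval x)) -
        2 * cubeAvg (fun x => bitVal (T.eval x) * bitVal (f x)) := by
    rw [← cubeAvg_const_mul, ← cubeAvg_add, ← cubeAvg_sub]
    congr 1
    funext x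
    cases f x <;> cases T.eval x <;> norm_num [bitVal]
  rw [e]
  set p := cubeAvg fun x => bitVal (f x)
  set q := cubeAvg fun x => bitVal (T.eval x)
  have q0 : 0 ≤ q := cubeAvg_nonneg fun _ => bitVal_nonneg _
  have q1 : q ≤ 1 := cubeAvg_le_one fun _ => bitVal_le_one _
  rw [abs_le] at h
  have h1 := min_le_left p (1 - p)
  have h2 := min_le_right p (1 - p)
  nlinarith [mul_le_mul_of_nonneg_left h1 (sub_nonneg.2 q1), mul_le_mul_of_nonneg_left h2 q0, h.2]

/-- The restriction of `g` to the leaf `ℓ`; the first query to a variable decides its value. -/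
def fixLeaf {β : Type*} : Leaf d → (Cube d → β) → Cube d → β
  | [], g => g
  | q :: p, g => fixLeaf p (fixCoord q.1 q.2 g)

theorem fixLeaf_comp {β γ : Type*} (h : β → γ) (ℓ : Leaf d) (g : Cube d → β) :
    fixLeaf ℓ (fun x => h (g x)) = fun x => h (fixLeaf ℓ g x) := by
  induction ℓ generalizing g with
  | nil => rfl
  | cons q p ih => exact ih (fixCoord q.1 q.2 g)

theorem fixLeaf_comp₂ {β γ η : Type*} (h : β → γ → η) (ℓ : Leaf d) (g : Cube d → β)
    (g' : Cube d → γ) :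
    fixLeaf ℓ (fun x => h (g x) (g' x)) = fun x => h (fixLeaf ℓ g x) (fixLeaf ℓ g' x) := by
  induction ℓ generalizing g g' with
  | nil => rfl
  | cons q p ih => exact ih (fixCoord q.1 q.2 g) (fixCoord q.1 q.2 g')

theorem fixLeaf_append {β : Type*} (ℓ : Leaf d) (i : Fin d) (v : Bool) (g : Cube d → β) :
    fixLeaf (ℓ ++ [(i, v)]) g = fixCoord i v (fixLeaf ℓ g) := by
  induction ℓ generalizing g with
  | nil => rfl
  | cons q p ih => exact ih (fixCoord q.1 q.2 g)

theorem exists_tree_fixLeaf (ℓ : Leaf d) (T : DecisionTree d Bool) :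
    ∃ U : DecisionTree d Bool, U.size ≤ T.size ∧ fixLeaf ℓ T.eval = U.eval := by
  induction ℓ generalizing T with
  | nil => exact ⟨T, le_rfl, rfl⟩
  | cons q p ih =>
    obtain ⟨U, hU, h⟩ := ih (T.restrict q.1 q.2)
    refine ⟨U, hU.trans (T.size_restrict_le _ _), ?_⟩
    rw [← h]
    change fixLeaf p _ = _
    congr 1
    funext x
    exact (T.eval_restrict _ _ x).symm

theorem IsMonotone.fixCoord {f : Cube d → Bool} (hf : IsMonotone f) (i : Fin d) (v : Bool) :
    IsMonotone (fixCoord i v f) := by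
  intro j
  by_cases hj : j = i
  · subst hj
    left; intro x; simp [_root_.fixCoord]
  · refine (hf j).imp (fun h x => ?_) fun h x => ?_
    · have := h (Function.update x i v)
      simpa [_root_.fixCoord, Function.update_comm hj] using this
    · have := h (Function.update x i v)
      simpa [_root_.fixCoord, Function.update_comm hj] using this

theorem IsMonotone.fixLeaf {f : Cube d → Bool} (hf : IsMonotone f) (ℓ : Leaf d) :
    IsMonotone (fixLeaf ℓ f) := by
  induction ℓ generalizing f with
  | nil => exact hf
  | cons q p ih => exact ih (hf.fixCoord q.1 q.2)

/-- For monotone functions the influence is the bias of the two restrictions. -/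
theorem IsMonotone.influence_eq {f : Cube d → Bool} (hf : IsMonotone f) (i : Fin d) :
    influence i (fun x => bitVal (f x)) =
      |cubeAvg (_root_.fixCoord i true fun x => bitVal (f x)) -
        cubeAvg (_root_.fixCoord i false fun x => bitVal (f x))| := by
  have mono : ∀ {a b : Bool}, a ≤ b → bitVal a ≤ bitVal b := by
    intro a b; cases a <;> cases b <;> simp [bitVal]
  rw [← cubeAvg_sub]
  unfold influence
  rcases hf i with h | h
  · rw [abs_of_nonneg]
    · congr 1; funext x
      exact abs_of_nonneg (sub_nonneg.2 (mono (h x)))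
    · exact cubeAvg_nonneg fun x => sub_nonneg.2 (mono (h x))
  · rw [abs_of_nonpos]
    · rw [← neg_one_mul, ← cubeAvg_const_mul]
      congr 1; funext x
      rw [neg_one_mul]
      exact abs_of_nonpos (sub_nonpos.2 (mono (h x)))
    · have := cubeAvg_mono (g := fun x => _root_.fixCoord i true (fun x => bitVal (f x)) x -
        _root_.fixCoord i false (fun x => bitVal (f x)) x) (h := fun _ => 0)
        fun x => sub_nonpos.2 (mono (h x))
      simpa [cubeAvg_const] using this

/-- No variable is queried twice on the path to `ℓ`. -/
def Leaf.Irredundant (ℓ : Leaf d) : Prop := (ℓ.map Prod.fst).Nodup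

theorem consistent_cons (q : Fin d × Bool) (p : Leaf d) (x : Cube d) :
    Consistent (q :: p) x ↔ x q.1 = q.2 ∧ Consistent p x := by
  simp [Consistent]

theorem consistent_append (ℓ : Leaf d) (i : Fin d) (v : Bool) (x : Cube d) :
    Consistent (ℓ ++ [(i, v)]) x ↔ Consistent ℓ x ∧ x i = v := by
  simp only [Consistent, List.mem_append, List.mem_singleton]
  constructor
  · intro h
    exact ⟨fun q hq => h q (Or.inl hq), h (i, v) (Or.inr rfl)⟩
  · rintro ⟨h, h'⟩ q (hq | rfl)
    · exact h q hq
    · exact h'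

theorem cubeAvg_consistent (ℓ : Leaf d) (hℓ : ℓ.Irredundant) (g : Cube d → ℝ) :
    cubeAvg (fun x => if Consistent ℓ x then g x else 0) =
      (1 / 2) ^ ℓ.length * cubeAvg (fixLeaf ℓ g) := by
  induction ℓ generalizing g with
  | nil => simp [Consistent, fixLeaf]
  | cons q p ih =>
    have hq : (q.1 ∉ p.map Prod.fst) ∧ (p.map Prod.fst).Nodup := by
      simpa [Leaf.Irredundant] using hℓ
    have e : (fun x => if Consistent (q :: p) x then g x else 0) =
        fun x => if x q.1 = q.2 then (if Consistent p x then g x else 0) else 0 := by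
      funext x
      by_cases h1 : x q.1 = q.2 <;> by_cases h2 : Consistent p x <;> simp [consistent_cons, h1, h2]
    rw [e, cubeAvg_indicator_coord]
    have e2 : fixCoord q.1 q.2 (fun x => if Consistent p x then g x else 0) =
        fun x => if Consistent p x then fixCoord q.1 q.2 g x else 0 := by
      funext x
      have : Consistent p (Function.update x q.1 q.2) ↔ Consistent p x := by
        refine forall₂_congr fun r hr => ?_
        rw [Function.update_of_ne]
        rintro h
        exact hq.1 (h ▸ List.mem_map_of_mem hr)
      simp only [fixCoord, this]
    rw [e2, ih hq.2, List.length_cons, pow_succ]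
    simp only [fixLeaf]
    ring

end

section

open scoped Classical

variable {d : ℕ}

namespace DecisionTree

theorem sum_leaves_node (i : Fin d) (lo hi : PartialTree d) (F : Leaf d → ℝ) :
    ∑ ℓ ∈ (node i lo hi).leaves, F ℓ =
      ∑ p ∈ lo.leaves, F ((i, false) :: p) + ∑ p ∈ hi.leaves, F ((i, true) :: p) := by
  rw [leaves, Finset.sum_union, Finset.sum_image, Finset.sum_image]
  · intro a _ b _ h; simpa using h
  · intro a _ b _ h; simpa using h
  · rw [Finset.disjoint_left]
    simp only [Finset.mem_image, not_exists, not_and, forall_exists_index, and_imp]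
    rintro _ p _ rfl q _ h
    simp at h

theorem mem_leaves_node (i : Fin d) (lo hi : PartialTree d) (ℓ : Leaf d) :
    ℓ ∈ (node i lo hi).leaves ↔
      (∃ p ∈ lo.leaves, (i, false) :: p = ℓ) ∨ ∃ p ∈ hi.leaves, (i, true) :: p = ℓ := by
  simp [leaves]

theorem card_leaves (T : PartialTree d) : (T.leaves.card : ℝ) = T.size := by
  have h : ∀ T : PartialTree d, ∑ ℓ ∈ T.leaves, (1 : ℝ) = T.size := by
    intro T
    induction T with
    | leaf a => simp [leaves, size]
    | node i lo hi h1 h2 => rw [sum_leaves_node, h1, h2]; simp [size]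
  simpa using h T

/-- Splitting a leaf replaces its term by those of its two children. -/
theorem sum_leaves_split (j : Fin d) (T : PartialTree d) (ℓ : Leaf d) (hℓ : ℓ ∈ T.leaves)
    (F : Leaf d → ℝ) :
    ∑ p ∈ (T.split ℓ j).leaves, F p =
      ∑ p ∈ T.leaves, F p - F ℓ + (F (ℓ ++ [(j, false)]) + F (ℓ ++ [(j, true)])) := by
  induction T generalizing ℓ F with
  | leaf a =>
    obtain rfl : ℓ = [] := by simpa [leaves] using hℓ
    simp only [split]
    rw [sum_leaves_node]
    simp [leaves]
  | node i lo hi h1 h2 =>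
    rcases (mem_leaves_node _ _ _ _).1 hℓ with ⟨p, hp, rfl⟩ | ⟨p, hp, rfl⟩
    · simp only [split, if_true, Bool.false_eq_true, if_false]
      rw [sum_leaves_node, sum_leaves_node, h1 p hp]
      simp only [List.cons_append]
      ring
    · simp only [split, if_true]
      rw [sum_leaves_node, sum_leaves_node, h2 p hp]
      simp only [List.cons_append]
      ring

theorem size_split (j : Fin d) (T : PartialTree d) (ℓ : Leaf d) (hℓ : ℓ ∈ T.leaves) :
    (T.split ℓ j).size = T.size + 1 := by
  have h := sum_leaves_split j T ℓ hℓ fun _ => 1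
  simp only [Finset.sum_const, nsmul_eq_mul, mul_one, card_leaves] at h
  have h' : ((T.split ℓ j).size : ℝ) = (T.size + 1 : ℕ) := by rw [h]; push_cast; ring
  exact_mod_cast h'

theorem mem_leaves_split (j : Fin d) (T : PartialTree d) (ℓ : Leaf d) (hℓ : ℓ ∈ T.leaves)
    (p : Leaf d) (hp : p ∈ (T.split ℓ j).leaves) : p ∈ T.leaves ∨ ∃ v, p = ℓ ++ [(j, v)] := by
  induction T generalizing ℓ p with
  | leaf a =>
    obtain rfl : ℓ = [] := by simpa [leaves] using hℓ
    right
    simpa [split, leaves] using hp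
  | node i lo hi h1 h2 =>
    rw [mem_leaves_node]
    rcases (mem_leaves_node _ _ _ _).1 hℓ with ⟨q, hq, rfl⟩ | ⟨q, hq, rfl⟩
    · simp only [split, if_true, Bool.false_eq_true, if_false, mem_leaves_node] at hp
      rcases hp with ⟨r, hr, rfl⟩ | hr
      · rcases h1 q hq r hr with h | ⟨v, rfl⟩
        · exact Or.inl (Or.inl ⟨r, h, rfl⟩)
        · exact Or.inr ⟨v, rfl⟩
      · exact Or.inl (Or.inr hr)
    · simp only [split, if_true, mem_leaves_node] at hp
      rcases hp with hr | ⟨r, hr, rfl⟩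
      · exact Or.inl (Or.inl hr)
      · rcases h2 q hq r hr with h | ⟨v, rfl⟩
        · exact Or.inl (Or.inr ⟨r, h, rfl⟩)
        · exact Or.inr ⟨v, rfl⟩

theorem exists_complete_split (j : Fin d) (T : PartialTree d) (ℓ : Leaf d) (hℓ : ℓ ∈ T.leaves)
    (lab : Leaf d → Bool) :
    ∃ lab' : Leaf d → Bool, ∀ x,
      ((T.split ℓ j).complete lab').eval x = (T.complete lab).eval x := by
  induction T generalizing ℓ lab with
  | leaf a =>
    obtain rfl : ℓ = [] := by simpa [leaves] using hℓ
    refine ⟨fun _ => lab [], fun x => ?_⟩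
    simp [split, complete, eval]
  | node i lo hi h1 h2 =>
    rcases (mem_leaves_node _ _ _ _).1 hℓ with ⟨q, hq, rfl⟩ | ⟨q, hq, rfl⟩
    · obtain ⟨lab', h⟩ := h1 q hq fun p => lab ((i, false) :: p)
      refine ⟨fun p => match p with
        | (_, false) :: p => lab' p
        | p => lab p, fun x => ?_⟩
      simp [split, complete, eval, h]
    · obtain ⟨lab', h⟩ := h2 q hq fun p => lab ((i, true) :: p)
      refine ⟨fun p => match p with
        | (_, true) :: p => lab' p
        | p => lab p, fun x => ?_⟩
      simp [split, complete, eval, h]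

/-- Every input reaches exactly one leaf. -/
theorem sum_consistent_leaves (T : PartialTree d) (lab : Leaf d → Bool) (h : Bool → ℝ)
    (x : Cube d) :
    ∑ ℓ ∈ T.leaves, (if Consistent ℓ x then h (lab ℓ) else 0) = h ((T.complete lab).eval x) := by
  induction T generalizing lab with
  | leaf a => simp [leaves, complete, eval, Consistent]
  | node i lo hi h1 h2 =>
    rw [sum_leaves_node]
    simp only [consistent_cons, complete, eval]
    cases hx : x i
    · simp only [Bool.false_eq_true, false_and, true_and, if_false, Finset.sum_const_zero, add_zero]
      exact h1 _
    · simp only [Bool.true_eq_false, false_and, true_and, if_false, if_true, Finset.sum_const_zero,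
        zero_add]
      exact h2 _

/-- The sum of `φ` over the leaves, weighted by the probability that a random path ends there. -/
noncomputable def leafSum (T : PartialTree d) (φ : Leaf d → ℝ) : ℝ :=
  ∑ ℓ ∈ T.leaves, (1 / 2) ^ ℓ.length * φ ℓ

theorem leafSum_node (i : Fin d) (lo hi : PartialTree d) (φ : Leaf d → ℝ) :
    (node i lo hi).leafSum φ =
      (lo.leafSum (fun p => φ ((i, false) :: p)) + hi.leafSum (fun p => φ ((i, true) :: p))) / 2 := by
  simp only [leafSum, sum_leaves_node, List.length_cons, pow_succ, add_div, Finset.sum_div]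
  congr 1 <;> exact Finset.sum_congr rfl fun _ _ => by ring

theorem leafSum_split (j : Fin d) (T : PartialTree d) (ℓ : Leaf d) (hℓ : ℓ ∈ T.leaves)
    (φ : Leaf d → ℝ) :
    (T.split ℓ j).leafSum φ = T.leafSum φ - (1 / 2) ^ ℓ.length *
      (φ ℓ - (1 / 2 * φ (ℓ ++ [(j, false)]) + 1 / 2 * φ (ℓ ++ [(j, true)]))) := by
  simp only [leafSum, sum_leaves_split j T ℓ hℓ, List.length_append, List.length_singleton,
    pow_succ]
  ring

theorem leafSum_add (T : PartialTree d) (φ ψ : Leaf d → ℝ) :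
    T.leafSum (fun ℓ => φ ℓ + ψ ℓ) = T.leafSum φ + T.leafSum ψ := by
  simp [leafSum, mul_add, Finset.sum_add_distrib]

theorem leafSum_mul_const (T : PartialTree d) (φ : Leaf d → ℝ) (c : ℝ) :
    T.leafSum (fun ℓ => φ ℓ * c) = T.leafSum φ * c := by
  simp [leafSum, Finset.sum_mul, mul_assoc]

theorem leafSum_mono (T : PartialTree d) {φ ψ : Leaf d → ℝ} (h : ∀ ℓ ∈ T.leaves, φ ℓ ≤ ψ ℓ) :
    T.leafSum φ ≤ T.leafSum ψ :=
  Finset.sum_le_sum fun ℓ hℓ => mul_le_mul_of_nonneg_left (h ℓ hℓ) (by positivity)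

theorem leafSum_one (T : PartialTree d) : T.leafSum (fun _ => 1) = 1 := by
  induction T with
  | leaf a => simp [leafSum, leaves]
  | node i lo hi h1 h2 => rw [leafSum_node, h1, h2]; norm_num

theorem leafSum_const (T : PartialTree d) (c : ℝ) : T.leafSum (fun _ => c) = c := by
  have := T.leafSum_mul_const (fun _ => 1) c
  simpa [leafSum_one] using this

/-- The entropy bound on the average depth of a tree. -/
theorem leafSum_length_le (T : PartialTree d) :
    T.leafSum (fun ℓ => (ℓ.length : ℝ)) ≤ Real.logb 2 T.size := by
  induction T with
  | leaf a => simp [leafSum, leaves, size]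
  | node i lo hi h1 h2 =>
    have h := logb_add_ge_average (a := lo.size) (b := hi.size) (by exact_mod_cast lo.size_pos)
      (by exact_mod_cast hi.size_pos)
    rw [leafSum_node]
    simp only [List.length_cons, Nat.cast_add, Nat.cast_one, leafSum_add, leafSum_one, size]
    linarith

/-- Some leaf is no deeper than in a balanced tree. -/
theorem exists_leaf_length_le (T : PartialTree d) :
    ∃ ℓ ∈ T.leaves, (ℓ.length : ℝ) ≤ Real.logb 2 T.size := by
  by_contra! h
  have hne : T.leaves.Nonempty := by
    rw [← Finset.card_pos]
    have := card_leaves T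
    have h0 := T.size_pos
    have : T.leaves.card = T.size := by exact_mod_cast this
    omega
  have h1 : T.leafSum (fun _ => Real.logb 2 T.size) < T.leafSum fun ℓ => (ℓ.length : ℝ) :=
    Finset.sum_lt_sum_of_nonempty hne fun ℓ hℓ =>
      mul_lt_mul_of_pos_left (h ℓ hℓ) (by positivity)
  rw [leafSum_const] at h1
  exact absurd T.leafSum_length_le (not_le.2 h1)

end DecisionTree

theorem treeError_eq (f : Cube d → Bool) (T : DecisionTree d Bool) :
    treeError f T = cubeAvg fun x => if f x ≠ T.eval x then 1 else 0 := by
  rw [treeError, cubeAvg, Finset.sum_boole]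

/-- The leaves of `T` can be labelled so that the error is at most `e`. -/
def CompletableTo (f : Cube d → Bool) (e : ℝ) (T : PartialTree d) : Prop :=
  ∃ lab, treeError f (T.complete lab) ≤ e

theorem CompletableTo.split {f : Cube d → Bool} {e : ℝ} {T : PartialTree d}
    (h : CompletableTo f e T) (ℓ : Leaf d) (hℓ : ℓ ∈ T.leaves) (j : Fin d) :
    CompletableTo f e (T.split ℓ j) := by
  obtain ⟨lab, h⟩ := h
  obtain ⟨lab', h'⟩ := DecisionTree.exists_complete_split j T ℓ hℓ lab
  exact ⟨lab', by simpa only [treeError, h'] using h⟩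

theorem exists_tree_treeError_eq_optError (f : Cube d → Bool) {s : ℕ} (hs : 1 ≤ s) :
    ∃ T : DecisionTree d Bool, T.size ≤ s ∧ treeError f T = optError f s := by
  have hfin : {e : ℝ | ∃ T : DecisionTree d Bool, T.size ≤ s ∧ treeError f T = e}.Finite := by
    refine (Set.finite_range fun g : Cube d → Bool =>
      ((Finset.univ.filter fun x : Cube d => f x ≠ g x).card : ℝ) / 2 ^ d).subset ?_
    rintro e ⟨T, -, rfl⟩
    exact ⟨T.eval, rfl⟩
  have hne : {e : ℝ | ∃ T : DecisionTree d Bool, T.size ≤ s ∧ treeError f T = e}.Nonempty :=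
    ⟨_, .leaf true, hs, rfl⟩
  exact hne.csInf_mem hfin

/-- The conditional expectation of `f` at a leaf. -/
noncomputable def leafMean (f : Cube d → Bool) (ℓ : Leaf d) : ℝ :=
  cubeAvg fun x => bitVal (fixLeaf ℓ f x)

theorem leafMean_mem (f : Cube d → Bool) (ℓ : Leaf d) : leafMean f ℓ ∈ Set.Icc (0 : ℝ) 1 :=
  ⟨cubeAvg_nonneg fun _ => bitVal_nonneg _, cubeAvg_le_one fun _ => bitVal_le_one _⟩

theorem leafMean_append (f : Cube d → Bool) (ℓ : Leaf d) (i : Fin d) (v : Bool) :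
    leafMean f (ℓ ++ [(i, v)]) = cubeAvg (fixCoord i v fun x => bitVal (fixLeaf ℓ f x)) := by
  unfold leafMean
  rw [fixLeaf_append]
  rfl

theorem leafMean_eq_half (f : Cube d → Bool) (ℓ : Leaf d) (i : Fin d) :
    leafMean f ℓ = (leafMean f (ℓ ++ [(i, false)]) + leafMean f (ℓ ++ [(i, true)])) / 2 := by
  rw [leafMean_append, leafMean_append]
  exact cubeAvg_eq_half i _

/-- The exact local gain of a query to `x_i` at the leaf `ℓ`. -/
noncomputable def exactGain (G : ℝ → ℝ) (f : Cube d → Bool) (ℓ : Leaf d) (i : Fin d) : ℝ :=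
  G (leafMean f ℓ) -
    (1 / 2 * G (leafMean f (ℓ ++ [(i, false)])) + 1 / 2 * G (leafMean f (ℓ ++ [(i, true)])))

theorem exactGain_ge {G : ℝ → ℝ} {κ : ℝ} (hG : IsStronglyConcave κ G) {f : Cube d → Bool}
    (hf : IsMonotone f) (ℓ : Leaf d) (i : Fin d) :
    κ / 2 * influence i (fun x => bitVal (fixLeaf ℓ f x)) ^ 2 ≤ exactGain G f ℓ i := by
  have h := hG _ (leafMean_mem f (ℓ ++ [(i, false)])) _ (leafMean_mem f (ℓ ++ [(i, true)]))
  rw [← leafMean_eq_half] at h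
  rw [(hf.fixLeaf ℓ).influence_eq, sq_abs, ← leafMean_append, ← leafMean_append]
  unfold exactGain
  linarith

theorem exactGain_le_one {G : ℝ → ℝ} (hG : IsImpurity G) (f : Cube d → Bool) (ℓ : Leaf d)
    (i : Fin d) : exactGain G f ℓ i ≤ 1 := by
  have h0 := (hG.mapsTo (leafMean_mem f ℓ)).2
  have h1 := (hG.mapsTo (leafMean_mem f (ℓ ++ [(i, false)]))).1
  have h2 := (hG.mapsTo (leafMean_mem f (ℓ ++ [(i, true)]))).1
  unfold exactGain
  linarith

theorem exactGain_of_mem {G : ℝ → ℝ} {f : Cube d → Bool} {ℓ : Leaf d}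
    {i : Fin d} (hi : i ∈ ℓ.map Prod.fst) : exactGain G f ℓ i = 0 := by
  have key : ∀ (ℓ : Leaf d) (f : Cube d → Bool) (v : Bool), i ∈ ℓ.map Prod.fst →
      fixLeaf (ℓ ++ [(i, v)]) f = fixLeaf ℓ f := by
    intro ℓ
    induction ℓ with
    | nil => intro f v h; simp at h
    | cons q p ih =>
      intro f v h
      by_cases hp : i ∈ p.map Prod.fst
      · exact ih _ _ hp
      · obtain rfl : i = q.1 := by
          rw [List.map_cons, List.mem_cons] at h
          exact h.resolve_right hp
        have comm : ∀ (p : Leaf d) (g : Cube d → Bool), fixCoord q.1 v g = g →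
            fixCoord q.1 v (fixLeaf p g) = fixLeaf p g := by
          intro p
          induction p with
          | nil => intro g hg; exact hg
          | cons r p ih' =>
            intro g hg
            apply ih'
            funext x
            by_cases hr : q.1 = r.1
            · simp [fixCoord, hr]
            · have := congrFun hg (Function.update x r.1 r.2)
              simp only [fixCoord] at this ⊢
              rw [← this, Function.update_comm hr]
        rw [fixLeaf_append]
        change fixCoord q.1 v (fixLeaf p _) = fixLeaf p _
        apply comm
        funext x
        simp [fixCoord]
  unfold exactGain leafMean
  rw [key ℓ f _ hi, key ℓ f _ hi]
  ring

/-- The error of the best completion of an irredundant tree. -/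
theorem exists_complete_treeError_eq (f : Cube d → Bool) (T : PartialTree d)
    (hT : ∀ ℓ ∈ T.leaves, ℓ.Irredundant) :
    ∃ lab, treeError f (T.complete lab) =
      T.leafSum fun ℓ => min (leafMean f ℓ) (1 - leafMean f ℓ) := by
  refine ⟨fun ℓ => decide (1 / 2 ≤ leafMean f ℓ), ?_⟩
  rw [treeError_eq]
  have e : ∀ x, (if f x ≠ (T.complete fun ℓ => decide (1 / 2 ≤ leafMean f ℓ)).eval x
      then (1 : ℝ) else 0) =
      ∑ ℓ ∈ T.leaves, if Consistent ℓ x then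
        (if f x ≠ decide (1 / 2 ≤ leafMean f ℓ) then (1 : ℝ) else 0) else 0 := fun x =>
    (T.sum_consistent_leaves (fun ℓ => decide (1 / 2 ≤ leafMean f ℓ))
      (fun b => if f x ≠ b then (1 : ℝ) else 0) x).symm
  rw [funext e, cubeAvg_sum]
  refine Finset.sum_congr rfl fun ℓ hℓ => ?_
  rw [cubeAvg_consistent ℓ (hT ℓ hℓ),
    fixLeaf_comp (fun b => if b ≠ decide (1 / 2 ≤ leafMean f ℓ) then (1 : ℝ) else 0) ℓ f]
  congr 1
  change _ = min (leafMean f ℓ) (1 - leafMean f ℓ)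
  by_cases h : 1 / 2 ≤ leafMean f ℓ
  · rw [min_eq_right (by linarith)]
    simp only [h, decide_true]
    have := cubeAvg_sub (fun _ => 1) fun x => bitVal (fixLeaf ℓ f x)
    rw [cubeAvg_const] at this
    unfold leafMean
    rw [← this]
    congr 1; funext x
    cases fixLeaf ℓ f x <;> simp [bitVal]
  · rw [min_eq_left (by linarith)]
    simp only [h, decide_false]
    unfold leafMean
    congr 1; funext x
    cases fixLeaf ℓ f x <;> simp [bitVal]

theorem treeError_eq_leafSum (f : Cube d → Bool) (T : PartialTree d)
    (hT : ∀ ℓ ∈ T.leaves, ℓ.Irredundant) (U : DecisionTree d Bool) :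
    treeError f U = T.leafSum fun ℓ =>
      cubeAvg fun x => if fixLeaf ℓ f x ≠ fixLeaf ℓ U.eval x then 1 else 0 := by
  rw [treeError_eq]
  have e : ∀ x, (if f x ≠ U.eval x then (1 : ℝ) else 0) =
      ∑ ℓ ∈ T.leaves, if Consistent ℓ x then (if f x ≠ U.eval x then (1 : ℝ) else 0) else 0 :=
    fun x => (T.sum_consistent_leaves (fun _ => true)
      (fun _ => if f x ≠ U.eval x then (1 : ℝ) else 0) x).symm
  rw [funext e, cubeAvg_sum]
  refine Finset.sum_congr rfl fun ℓ hℓ => ?_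
  rw [cubeAvg_consistent ℓ (hT ℓ hℓ),
    fixLeaf_comp₂ (fun a b : Bool => if a ≠ b then (1 : ℝ) else 0)]

/-- An irredundant tree far from every small tree has queries of large exact gain. -/
theorem exists_large_exactGain {G : ℝ → ℝ} {κ ε : ℝ} (hd : 0 < d) (hκ : 0 < κ) (hε : 0 < ε)
    (hG : IsStronglyConcave κ G) {f : Cube d → Bool} (hf : IsMonotone f) {s : ℕ} (hs : 2 ≤ s)
    (T : PartialTree d) (hT : ∀ ℓ ∈ T.leaves, ℓ.Irredundant)
    (hfar : ¬ CompletableTo f (optError f s + ε / 2) T) :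
    ∃ best : Leaf d → Fin d,
      κ * ε ^ 2 / (8 * Real.logb 2 s ^ 2) ≤ T.leafSum fun ℓ => exactGain G f ℓ (best ℓ) := by
  have : Nonempty (Fin d) := ⟨⟨0, hd⟩⟩
  have hmax : ∀ ℓ : Leaf d, ∃ i, ∀ j, influence j (fun x => bitVal (fixLeaf ℓ f x)) ≤
      influence i (fun x => bitVal (fixLeaf ℓ f x)) := fun ℓ => Finite.exists_max _
  choose best hbest using hmax
  refine ⟨best, ?_⟩
  set M : Leaf d → ℝ := fun ℓ => influence (best ℓ) (fun x => bitVal (fixLeaf ℓ f x)) with hM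
  have hM0 : ∀ ℓ, 0 ≤ M ℓ := fun ℓ => cubeAvg_nonneg fun _ => abs_nonneg _
  have hlog : 0 < Real.logb 2 s := Real.logb_pos (by norm_num) (by exact_mod_cast hs)
  obtain ⟨U, hU, hUopt⟩ := exists_tree_treeError_eq_optError f (by omega : 1 ≤ s)
  obtain ⟨lab, hlab⟩ := exists_complete_treeError_eq f T hT
  have h1 : optError f s + ε / 2 < T.leafSum fun ℓ => min (leafMean f ℓ) (1 - leafMean f ℓ) := by
    rw [← hlab]
    by_contra! h
    exact hfar ⟨lab, h⟩
  have h2 : (T.leafSum fun ℓ => min (leafMean f ℓ) (1 - leafMean f ℓ)) ≤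
      optError f s + T.leafSum M * Real.logb 2 s := by
    rw [← hUopt, treeError_eq_leafSum f T hT U, ← DecisionTree.leafSum_mul_const,
      ← DecisionTree.leafSum_add]
    refine T.leafSum_mono fun ℓ _ => ?_
    obtain ⟨V, hV, hVU⟩ := exists_tree_fixLeaf ℓ U
    rw [hVU]
    exact min_cubeAvg_le_of_influence_le (fixLeaf ℓ f) (hbest ℓ) (hM0 ℓ) V (hV.trans hU)
  set μ := ε / (2 * Real.logb 2 s) with hμ
  have hμ0 : 0 < μ := by positivity
  have h3 : μ ≤ T.leafSum M := by
    rw [hμ, div_le_iff₀ (by positivity)]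
    linarith
  have h4 : T.leafSum M * (κ * μ) ≤
      (T.leafSum fun ℓ => exactGain G f ℓ (best ℓ)) + κ / 2 * μ ^ 2 := by
    rw [← DecisionTree.leafSum_mul_const, ← T.leafSum_const (κ / 2 * μ ^ 2),
      ← DecisionTree.leafSum_add]
    refine T.leafSum_mono fun ℓ _ => ?_
    have := exactGain_ge hG hf ℓ (best ℓ)
    change κ / 2 * M ℓ ^ 2 ≤ _ at this
    nlinarith [mul_nonneg hκ.le (sq_nonneg (M ℓ - μ))]
  have h5 : μ * (κ * μ) ≤ T.leafSum M * (κ * μ) := by gcongr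
  have h6 : κ * ε ^ 2 / (8 * Real.logb 2 s ^ 2) = κ / 2 * μ ^ 2 := by
    rw [hμ]; field_simp; ring
  rw [h6]
  linarith

theorem logb_succ_le {L : ℕ} (hL : 0 < L) :
    Real.logb 2 ((L + 1 : ℕ) : ℝ) ≤ Real.logb 2 L + 2 / L := by
  have hL' : (0 : ℝ) < L := by exact_mod_cast hL
  have e : ((L + 1 : ℕ) : ℝ) = L * (1 + 1 / L) := by push_cast; field_simp
  rw [e, Real.logb_mul hL'.ne' (by positivity)]
  gcongr
  unfold Real.logb
  have h2 : (1 : ℝ) / 2 < Real.log 2 := by have := Real.log_two_gt_d9; linarith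
  rw [div_le_iff₀ (by linarith)]
  have h1 : Real.log (1 + 1 / L) ≤ 1 / L := by
    have := Real.log_le_sub_one_of_pos (by positivity : (0 : ℝ) < 1 + 1 / L)
    linarith
  calc Real.log (1 + 1 / L) ≤ 2 / L * (1 / 2) := h1.trans_eq (by ring)
    _ ≤ 2 / L * Real.log 2 := by gcongr

/-- The invariant of the growing phase: the impurity falls with the logarithm of the size, up to
the inaccuracies of the gains, which are paid for by the average depth. -/
structure HasPurity (G : ℝ → ℝ) (f : Cube d → Bool) (η : ℝ) (T : PartialTree d) : Prop where
  irredundant : ∀ ℓ ∈ T.leaves, ℓ.Irredundant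
  impurity_le : T.leafSum (fun ℓ => G (leafMean f ℓ)) ≤
    1 - η / 4 * Real.logb 2 T.size + η / 16 * T.leafSum fun ℓ => (ℓ.length : ℝ)

theorem hasPurity_leaf {G : ℝ → ℝ} (hG : IsImpurity G) (f : Cube d → Bool) (η : ℝ) :
    HasPurity G f η (.leaf ()) where
  irredundant := by
    intro ℓ hℓ
    obtain rfl : ℓ = [] := by simpa [DecisionTree.leaves] using hℓ
    exact List.nodup_nil
  impurity_le := by
    simpa [DecisionTree.leafSum, DecisionTree.leaves, DecisionTree.size] using
      (hG.mapsTo (leafMean_mem f [])).2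

theorem HasPurity.size_ne {G : ℝ → ℝ} (hG : IsImpurity G) {f : Cube d → Bool} {η : ℝ} {m : ℕ}
    (hm : 16 / 3 < η * m) {T : PartialTree d} (h : HasPurity G f η T) (hη : 0 < η) :
    T.size ≠ 2 ^ m := by
  intro hs
  have h1 := h.impurity_le
  have h2 : 0 ≤ T.leafSum fun ℓ => G (leafMean f ℓ) :=
    Finset.sum_nonneg fun ℓ _ =>
      mul_nonneg (by positivity) (hG.mapsTo (leafMean_mem f ℓ)).1
  have h3 : Real.logb 2 T.size = m := by
    rw [hs]; push_cast; rw [Real.logb_pow, Real.logb_self_eq_one (by norm_num)]; simp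
  have h4 := T.leafSum_length_le
  rw [h3] at h1 h4
  nlinarith [mul_le_mul_of_nonneg_left h4 hη.le]

/-- Splitting a leaf of maximal estimated gain preserves the invariant. -/
theorem HasPurity.split {G : ℝ → ℝ} {κ ε : ℝ} (hd : 0 < d) (hκ : 0 < κ) (hε : 0 < ε)
    (hI : IsImpurity G) (hG : IsStronglyConcave κ G) {f : Cube d → Bool} (hf : IsMonotone f)
    {s : ℕ} (hs : 2 ≤ s) {m : ℕ} {η : ℝ} (hη : η = κ * ε ^ 2 / (8 * Real.logb 2 s ^ 2))
    (hηm : (1 / 2) ^ m ≤ η / 4)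
    {T : PartialTree d} (hT : HasPurity G f η T) (hsize : T.size < 2 ^ m)
    (hfar : ¬ CompletableTo f (optError f s + ε / 2) T)
    {A : Finset (Leaf d)} (hA : A ⊆ T.leaves) (hAm : ∀ ℓ ∈ T.leaves, ℓ.length ≤ 2 * m → ℓ ∈ A)
    (est : Leaf d → Fin d → ℝ)
    (hest : ∀ ℓ ∈ T.leaves, ℓ.length ≤ 2 * m → ∀ i, |est ℓ i - exactGain G f ℓ i| ≤ η / 16)
    (hest1 : ∀ ℓ ∈ T.leaves, ∀ i, est ℓ i ≤ 1)
    (hest0 : ∀ ℓ ∈ T.leaves, ∀ i ∈ ℓ.map Prod.fst, est ℓ i ≤ 0)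
    {ℓ₀ : Leaf d} {i₀ : Fin d} (hℓ₀ : ℓ₀ ∈ A)
    (hmax : ∀ ℓ ∈ A, ∀ i, (1 / 2) ^ ℓ.length * est ℓ i ≤ (1 / 2) ^ ℓ₀.length * est ℓ₀ i₀) :
    HasPurity G f η (T.split ℓ₀ i₀) := by
  obtain ⟨best, hbest⟩ := exists_large_exactGain hd hκ hε hG hf hs T hT.irredundant hfar
  rw [← hη] at hbest
  have hη0 : 0 < η := by
    have : (0 : ℝ) < (1 / 2) ^ m := by positivity
    linarith
  set E := (1 / 2 : ℝ) ^ ℓ₀.length * est ℓ₀ i₀ with hE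
  have hL0 : (0 : ℝ) < T.size := by exact_mod_cast T.size_pos
  have hLm : (T.size : ℝ) * (1 / 2) ^ m ≤ 1 := by
    have : (T.size : ℝ) ≤ 2 ^ m := by exact_mod_cast hsize.le
    calc (T.size : ℝ) * (1 / 2) ^ m ≤ 2 ^ m * (1 / 2) ^ m := by gcongr
      _ = 1 := by rw [← mul_pow]; norm_num
  have hdeep : ∀ ℓ : Leaf d, ¬ ℓ.length ≤ 2 * m →
      (1 / 2 : ℝ) ^ ℓ.length ≤ (1 / 2) ^ m * (1 / 2) ^ m / 2 := by
    intro ℓ hℓ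
    calc (1 / 2 : ℝ) ^ ℓ.length ≤ (1 / 2) ^ (m + m + 1) :=
          pow_le_pow_of_le_one (by norm_num) (by norm_num) (by omega)
      _ = _ := by rw [pow_succ, pow_add]; ring
  have hw : (0 : ℝ) < (1 / 2) ^ m := by positivity
  have hsum : η - η / 16 ≤ T.size * (max E 0 + (1 / 2) ^ m * (1 / 2) ^ m / 2) := by
    have h1 : T.leafSum (fun ℓ => exactGain G f ℓ (best ℓ)) - T.leafSum (fun _ => η / 16) ≤
        ∑ ℓ ∈ T.leaves, (max E 0 + (1 / 2) ^ m * (1 / 2) ^ m / 2) := by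
      simp only [DecisionTree.leafSum]
      rw [← Finset.sum_sub_distrib]
      refine Finset.sum_le_sum fun ℓ hℓ => ?_
      have hwl : (0 : ℝ) < (1 / 2) ^ ℓ.length := by positivity
      rw [← mul_sub]
      by_cases h : ℓ.length ≤ 2 * m
      · have h1 := hest ℓ hℓ h (best ℓ)
        rw [abs_le] at h1
        have h2 := hmax ℓ (hAm ℓ hℓ h) (best ℓ)
        have h3 : (1 / 2 : ℝ) ^ ℓ.length * (exactGain G f ℓ (best ℓ) - η / 16) ≤
            (1 / 2) ^ ℓ.length * est ℓ (best ℓ) := by gcongr; linarith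
        have := le_max_left E 0
        have := mul_pos hw hw
        linarith
      · have h1 := exactGain_le_one hI f ℓ (best ℓ)
        have h2 := hdeep ℓ h
        have := le_max_right E 0
        nlinarith
    rw [Finset.sum_const, nsmul_eq_mul, DecisionTree.card_leaves, DecisionTree.leafSum_const] at h1
    linarith
  have hE1 : η / 2 ≤ T.size * max E 0 := by
    nlinarith
  have hEpos : 0 < E := by
    by_contra! h
    rw [max_eq_right h] at hE1
    linarith
  rw [max_eq_left hEpos.le] at hE1
  have hℓT := hA hℓ₀
  have hestpos : 0 < est ℓ₀ i₀ := pos_of_mul_pos_right hEpos (by positivity)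
  have hshallow : ℓ₀.length ≤ 2 * m := by
    by_contra h
    have h1 := hdeep ℓ₀ h
    have h2 : E ≤ (1 / 2) ^ m * (1 / 2) ^ m / 2 := by
      have := hest1 ℓ₀ hℓT i₀
      have hwl : (0 : ℝ) < (1 / 2) ^ ℓ₀.length := by positivity
      nlinarith
    nlinarith [mul_le_mul_of_nonneg_left h2 hL0.le]
  have hnot : i₀ ∉ ℓ₀.map Prod.fst := fun h => absurd (hest0 ℓ₀ hℓT i₀ h) (not_le.2 hestpos)
  refine ⟨fun ℓ hℓ => ?_, ?_⟩
  · rcases DecisionTree.mem_leaves_split i₀ T ℓ₀ hℓT ℓ hℓ with h | ⟨v, rfl⟩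
    · exact hT.irredundant ℓ h
    · have h := hT.irredundant ℓ₀ hℓT
      unfold Leaf.Irredundant at h ⊢
      rw [List.map_append, List.nodup_append]
      refine ⟨h, by simp, ?_⟩
      intro a ha b hb hab
      simp only [List.map_cons, List.map_nil, List.mem_singleton] at hb
      exact hnot (by rw [← hb, ← hab]; exact ha)
  · have hlen : (T.split ℓ₀ i₀).leafSum (fun ℓ => (ℓ.length : ℝ)) =
        T.leafSum (fun ℓ => (ℓ.length : ℝ)) + (1 / 2) ^ ℓ₀.length := by
      rw [DecisionTree.leafSum_split i₀ T ℓ₀ hℓT]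
      simp only [List.length_append, List.length_singleton]
      push_cast
      ring
    rw [hlen, DecisionTree.size_split i₀ T ℓ₀ hℓT,
      DecisionTree.leafSum_split i₀ T ℓ₀ hℓT]
    change _ - (1 / 2) ^ ℓ₀.length * exactGain G f ℓ₀ i₀ ≤ _
    have h1 := (abs_le.1 (hest ℓ₀ hℓT hshallow i₀)).2
    have h2 : E - (1 / 2) ^ ℓ₀.length * (η / 16) ≤ (1 / 2) ^ ℓ₀.length * exactGain G f ℓ₀ i₀ := by
      rw [hE, ← mul_sub]
      gcongr
      linarith
    have h3 := mul_le_mul_of_nonneg_left (logb_succ_le T.size_pos) (by linarith : 0 ≤ η / 4)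
    have h4 : η / 4 * (2 / T.size) ≤ E := by
      rw [show η / 4 * (2 / (T.size : ℝ)) = (η / 2) / T.size by ring, div_le_iff₀ hL0]
      linarith
    have h5 := hT.impurity_le
    linarith

end

section

open scoped Classical

theorem exp_sub_one_le {x : ℝ} (h0 : 0 ≤ x) (h1 : x ≤ 1) : Real.exp x - 1 ≤ x + x ^ 2 := by
  have := (abs_le.1 (Real.abs_exp_sub_one_sub_id_le (x := x) (by rwa [abs_of_nonneg h0]))).2
  linarith

/-- A Chernoff bound for counts whose generating function is dominated by a binomial one. -/
theorem card_upper_tail_le {ι : Type*} (Ω : Finset ι) (N : ι → ℕ) (b : ℕ) {μ γ : ℝ} (hμ0 : 0 ≤ μ)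
    (hμ1 : μ ≤ 1) (hγ0 : 0 ≤ γ) (hγ1 : γ ≤ 1)
    (h : ∀ w : ℝ, 0 ≤ w → ∑ ω ∈ Ω, (1 + w) ^ N ω ≤ Ω.card * (1 + w * μ) ^ b) :
    ((Ω.filter fun ω => (μ + γ) * b ≤ N ω).card : ℝ) ≤ Real.exp (-(b * γ ^ 2 / 4)) * Ω.card := by
  set l := γ / 2 with hl
  have hl0 : 0 ≤ l := by positivity
  have hw : 0 ≤ Real.exp l - 1 := by linarith [Real.one_le_exp hl0]
  have h1 := h _ hw
  have h2 : (1 + (Real.exp l - 1) * μ) ^ b ≤ Real.exp (b * (μ * l + l ^ 2)) := by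
    rw [Real.exp_nat_mul]
    have hexp := exp_sub_one_le hl0 (by linarith)
    refine pow_le_pow_left₀ (by positivity) ?_ _
    have := Real.add_one_le_exp (μ * l + l ^ 2)
    nlinarith [sq_nonneg l]
  have h3 : ((Ω.filter fun ω => (μ + γ) * b ≤ N ω).card : ℝ) * Real.exp (l * ((μ + γ) * b)) ≤
      ∑ ω ∈ Ω, (1 + (Real.exp l - 1)) ^ N ω := by
    rw [← nsmul_eq_mul, ← Finset.sum_const]
    refine (Finset.sum_le_sum fun ω hω => ?_).trans
      (Finset.sum_le_sum_of_subset_of_nonneg (Finset.filter_subset _ _) fun _ _ _ => by positivity)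
    rw [add_sub_cancel, ← Real.exp_nat_mul, Real.exp_le_exp, mul_comm (N ω : ℝ)]
    exact mul_le_mul_of_nonneg_left (Finset.mem_filter.1 hω).2 hl0
  have h4 : ((Ω.filter fun ω => (μ + γ) * b ≤ N ω).card : ℝ) * Real.exp (l * ((μ + γ) * b)) ≤
      Ω.card * Real.exp (b * (μ * l + l ^ 2)) :=
    h3.trans (h1.trans (mul_le_mul_of_nonneg_left h2 (by positivity)))
  rw [← le_div_iff₀ (Real.exp_pos _), mul_div_assoc, ← Real.exp_sub] at h4
  have e : b * (μ * l + l ^ 2) - l * ((μ + γ) * b) = -(b * γ ^ 2 / 4) := by rw [hl]; ring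
  rw [e] at h4
  linarith

theorem card_two_sided_tail_le {ι : Type*} (Ω : Finset ι) (N N' : ι → ℕ) (b : ℕ) {μ γ : ℝ}
    (hμ0 : 0 ≤ μ) (hμ1 : μ ≤ 1) (hγ0 : 0 ≤ γ) (hγ1 : γ ≤ 1) (hN : ∀ ω ∈ Ω, N ω + N' ω = b)
    (h : ∀ w : ℝ, 0 ≤ w → ∑ ω ∈ Ω, (1 + w) ^ N ω ≤ Ω.card * (1 + w * μ) ^ b)
    (h' : ∀ w : ℝ, 0 ≤ w → ∑ ω ∈ Ω, (1 + w) ^ N' ω ≤ Ω.card * (1 + w * (1 - μ)) ^ b) :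
    ((Ω.filter fun ω => γ * b ≤ |(N ω : ℝ) - μ * b|).card : ℝ) ≤
      2 * Real.exp (-(b * γ ^ 2 / 4)) * Ω.card := by
  have h1 := card_upper_tail_le Ω N b hμ0 hμ1 hγ0 hγ1 h
  have h2 := card_upper_tail_le Ω N' b (sub_nonneg.2 hμ1) (by linarith) hγ0 hγ1 h'
  have hsub : (Ω.filter fun ω => γ * b ≤ |(N ω : ℝ) - μ * b|) ⊆
      (Ω.filter fun ω => (μ + γ) * b ≤ N ω) ∪ Ω.filter fun ω => (1 - μ + γ) * b ≤ N' ω := by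
    intro ω hω
    rw [Finset.mem_filter] at hω
    rw [Finset.mem_union, Finset.mem_filter, Finset.mem_filter]
    have e : (N ω : ℝ) + N' ω = b := by exact_mod_cast hN ω hω.1
    rcases le_abs.1 hω.2 with h | h
    · exact Or.inl ⟨hω.1, by linarith⟩
    · exact Or.inr ⟨hω.1, by linarith⟩
  have h3 : ((Ω.filter fun ω => γ * b ≤ |(N ω : ℝ) - μ * b|).card : ℝ) ≤
      (Ω.filter fun ω => (μ + γ) * b ≤ N ω).card +
        (Ω.filter fun ω => (1 - μ + γ) * b ≤ N' ω).card := by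
    exact_mod_cast (Finset.card_le_card hsub).trans (Finset.card_union_le _ _)
  linarith

theorem sum_pow_card_filter_eq {α : Type*} [Fintype α] [Nonempty α] (n : ℕ) (P : α → Prop)
    [DecidablePred P] (w : ℝ) :
    ∑ xs : Fin n → α, (1 + w) ^ (Finset.univ.filter fun k => P (xs k)).card =
      (Finset.univ : Finset (Fin n → α)).card *
        (1 + w * ((Finset.univ.filter P).card / Fintype.card α)) ^ n := by
  have h1 : ∀ xs : Fin n → α, (1 + w) ^ (Finset.univ.filter fun k => P (xs k)).card =
      ∏ k, if P (xs k) then 1 + w else 1 := by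
    intro xs
    rw [Finset.prod_ite]
    simp
  have h2 : ∑ a : α, (if P a then 1 + w else 1) =
      Fintype.card α * (1 + w * ((Finset.univ.filter P).card / Fintype.card α)) := by
    have hc : (Fintype.card α : ℝ) ≠ 0 := by exact_mod_cast Fintype.card_ne_zero
    have : ∀ a : α, (if P a then 1 + w else 1) = 1 + w * if P a then 1 else 0 := by
      intro a; split_ifs <;> simp
    simp_rw [this, Finset.sum_add_distrib, ← Finset.mul_sum, Finset.sum_boole]
    simp
    field_simp
  rw [Finset.sum_congr rfl fun xs _ => h1 xs]
  have h3 := Finset.sum_pow' (Finset.univ : Finset α) (fun a => if P a then 1 + w else 1) n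
  rw [Fintype.piFinset_univ] at h3
  rw [← h3, h2, mul_pow]
  simp

/-- Hoeffding's inequality for independent samples from the uniform distribution. -/
theorem card_sample_deviation_le {α : Type*} [Fintype α] [Nonempty α] (n : ℕ) (P : α → Prop)
    {γ : ℝ} (hγ0 : 0 ≤ γ) (hγ1 : γ ≤ 1) :
    (((Finset.univ : Finset (Fin n → α)).filter fun xs => γ * n ≤
      |((Finset.univ.filter fun k => P (xs k)).card : ℝ) -
        (Finset.univ.filter P).card / Fintype.card α * n|).card : ℝ) ≤
      2 * Real.exp (-(n * γ ^ 2 / 4)) * (Finset.univ : Finset (Fin n → α)).card := by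
  have hc : (0 : ℝ) < Fintype.card α := by exact_mod_cast Fintype.card_pos
  have hle : ((Finset.univ.filter P).card : ℝ) ≤ Fintype.card α := by
    exact_mod_cast Finset.card_le_univ _
  have hcompl : ((Finset.univ.filter fun a => ¬ P a).card : ℝ) / Fintype.card α =
      1 - (Finset.univ.filter P).card / Fintype.card α := by
    have := Finset.card_filter_add_card_filter_not (s := (Finset.univ : Finset α)) P
    have h : ((Finset.univ.filter P).card : ℝ) + (Finset.univ.filter fun a => ¬ P a).card =
        Fintype.card α := by exact_mod_cast this
    field_simp
    linarith
  refine card_two_sided_tail_le (Finset.univ : Finset (Fin n → α))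
    (fun xs => (Finset.univ.filter fun k => P (xs k)).card)
    (fun xs => (Finset.univ.filter fun k => ¬ P (xs k)).card) n
    (μ := (Finset.univ.filter P).card / Fintype.card α) ?_ ?_ hγ0 hγ1 ?_ ?_ ?_
  · positivity
  · exact (div_le_one hc).2 hle
  · intro xs _
    have := Finset.card_filter_add_card_filter_not (s := (Finset.univ : Finset (Fin n)))
      fun k => P (xs k)
    rw [Finset.card_univ, Fintype.card_fin] at this
    exact this
  · intro w _
    exact (sum_pow_card_filter_eq n P w).le
  · intro w _
    rw [← hcompl]
    exact (sum_pow_card_filter_eq n (fun a => ¬ P a) w).le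

theorem choose_mul_pow_le {M N : ℕ} (h : M ≤ N) (j : ℕ) :
    M.choose j * N ^ j ≤ N.choose j * M ^ j := by
  induction j with
  | zero => simp
  | succ j ih =>
    have h1 := Nat.choose_succ_right_eq M j
    have h2 := Nat.choose_succ_right_eq N j
    have h3 : (M - j) * N ≤ (N - j) * M := by
      rw [Nat.sub_mul, Nat.sub_mul, mul_comm N M]
      have := Nat.mul_le_mul_left j h
      omega
    refine Nat.le_of_mul_le_mul_right ?_ (Nat.succ_pos j)
    calc M.choose (j + 1) * N ^ (j + 1) * (j + 1)
        = (M.choose (j + 1) * (j + 1)) * (N ^ j * N) := by ring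
      _ = (M.choose j * N ^ j) * ((M - j) * N) := by rw [h1]; ring
      _ ≤ (N.choose j * M ^ j) * ((N - j) * M) := Nat.mul_le_mul ih h3
      _ = (N.choose (j + 1) * (j + 1)) * (M ^ j * M) := by rw [h2]; ring
      _ = N.choose (j + 1) * M ^ (j + 1) * (j + 1) := by ring

/-- The generating function of the hypergeometric distribution is dominated by the binomial one. -/
theorem sum_powersetCard_pow_card_inter_le {α : Type*} [DecidableEq α] (S P : Finset α) (hP : P ⊆ S) {b : ℕ}
    (hS : 0 < S.card) {w : ℝ} (hw : 0 ≤ w) :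
    ∑ B ∈ S.powersetCard b, (1 + w) ^ (B ∩ P).card ≤
      (S.powersetCard b).card * (1 + w * (P.card / S.card)) ^ b := by
  set N := S.card with hN
  set M := P.card with hM
  have hMN : M ≤ N := Finset.card_le_card hP
  set x := w * ((M : ℝ) / N) with hx
  have hx0 : 0 ≤ x := by positivity
  set g : ℕ → ℝ := fun j => if j ≤ b then ((N - j).choose (b - j) : ℝ) * w ^ j else 0 with hg
  have h1 : ∑ B ∈ S.powersetCard b, (1 + w) ^ (B ∩ P).card = ∑ J ∈ P.powerset, g J.card := by
    have : ∀ B : Finset α, (1 + w) ^ (B ∩ P).card =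
        ∑ J ∈ P.powerset, if J ⊆ B then w ^ J.card else 0 := by
      intro B
      rw [← Finset.prod_const, Finset.prod_one_add, ← Finset.sum_filter]
      refine Finset.sum_congr ?_ fun J _ => by rw [Finset.prod_const]
      ext J
      simp only [Finset.mem_powerset, Finset.mem_filter, Finset.subset_inter_iff, and_comm]
    simp_rw [this]
    rw [Finset.sum_comm]
    refine Finset.sum_congr rfl fun J hJ => ?_
    rw [← Finset.sum_filter, Finset.sum_const, nsmul_eq_mul]
    simp only [hg]
    split_ifs with hj
    · rw [Finset.card_filter_powersetCard_subset J S b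
        ((Finset.mem_powerset.1 hJ).trans hP) hj]
    · rw [Finset.filter_false_of_mem, Finset.card_empty]
      · simp
      · intro B hB hJB
        have := Finset.card_le_card hJB
        rw [(Finset.mem_powersetCard.1 hB).2] at this
        exact hj this
  have h2 : ∀ j, (M.choose j : ℝ) * g j ≤ N.choose b * (b.choose j * x ^ j) := by
    intro j
    simp only [hg]
    split_ifs with hj
    · have e : (N.choose b : ℝ) * b.choose j = N.choose j * (N - j).choose (b - j) := by
        exact_mod_cast Nat.choose_mul hj
      have c : (M.choose j : ℝ) ≤ N.choose j * (M / N : ℝ) ^ j := by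
        rw [div_pow, mul_div_assoc', le_div_iff₀ (by positivity)]
        exact_mod_cast choose_mul_pow_le hMN j
      calc (M.choose j : ℝ) * ((N - j).choose (b - j) * w ^ j)
          ≤ (N.choose j * (M / N : ℝ) ^ j) * ((N - j).choose (b - j) * w ^ j) := by gcongr
        _ = (N.choose j * (N - j).choose (b - j)) * x ^ j := by rw [hx, mul_pow]; ring
        _ = N.choose b * (b.choose j * x ^ j) := by rw [← e]; ring
    · rw [mul_zero]; positivity
  have h3 : (1 + x) ^ b = ∑ j ∈ Finset.range (b + 1), (b.choose j : ℝ) * x ^ j := by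
    rw [add_comm, add_pow]
    exact Finset.sum_congr rfl fun j _ => by rw [one_pow]; ring
  rw [h1, Finset.sum_powerset_apply_card, Finset.card_powersetCard, h3]
  simp only [nsmul_eq_mul]
  calc ∑ j ∈ Finset.range (M + 1), (M.choose j : ℝ) * g j
      ≤ ∑ j ∈ Finset.range (M + 1), (N.choose b : ℝ) * (b.choose j * x ^ j) :=
        Finset.sum_le_sum fun j _ => h2 j
    _ ≤ ∑ j ∈ Finset.range (max (M + 1) (b + 1)), (N.choose b : ℝ) * (b.choose j * x ^ j) :=
        Finset.sum_le_sum_of_subset_of_nonneg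
          (Finset.range_subset_range.2 (le_max_left _ _)) fun _ _ _ => by positivity
    _ = ∑ j ∈ Finset.range (b + 1), (N.choose b : ℝ) * (b.choose j * x ^ j) := by
        symm
        refine Finset.sum_subset (Finset.range_subset_range.2 (le_max_right _ _)) fun j _ hj => ?_
        rw [Nat.choose_eq_zero_of_lt (n := b) (by simpa using hj)]
        simp
    _ = _ := by rw [Finset.mul_sum]

/-- Hoeffding's inequality for sampling without replacement. -/
theorem card_powersetCard_deviation_le {α : Type*} [DecidableEq α] (S P : Finset α) (hP : P ⊆ S) {b : ℕ}
    (hS : 0 < S.card) {γ : ℝ} (hγ0 : 0 ≤ γ) (hγ1 : γ ≤ 1) :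
    (((S.powersetCard b).filter fun B => γ * b ≤
      |((B ∩ P).card : ℝ) - P.card / S.card * b|).card : ℝ) ≤
      2 * Real.exp (-(b * γ ^ 2 / 4)) * (S.powersetCard b).card := by
  have hS' : (0 : ℝ) < S.card := by exact_mod_cast hS
  have hle : (P.card : ℝ) ≤ S.card := by exact_mod_cast Finset.card_le_card hP
  have hcompl : ((S \ P).card : ℝ) / S.card = 1 - P.card / S.card := by
    rw [Finset.cast_card_sdiff hP]
    field_simp
  refine card_two_sided_tail_le _ (fun B => (B ∩ P).card) (fun B => (B ∩ (S \ P)).card) b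
    (by positivity) ((div_le_one hS').2 hle) hγ0 hγ1 (fun B hB => ?_) (fun w hw => ?_)
    fun w hw => ?_
  · obtain ⟨h1, h2⟩ := Finset.mem_powersetCard.1 hB
    have : B ∩ (S \ P) = B \ P := by
      ext a
      simp only [Finset.mem_inter, Finset.mem_sdiff]
      exact ⟨fun h => ⟨h.1, h.2.2⟩, fun h => ⟨h.1, h1 h.1, h.2⟩⟩
    rw [this, Finset.card_inter_add_card_sdiff, h2]
  · exact sum_powersetCard_pow_card_inter_le S P hP hS hw
  · rw [← hcompl]
    exact sum_powersetCard_pow_card_inter_le S (S \ P) Finset.sdiff_subset hS hw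

namespace PMF

theorem toOuterMeasure_uniformOfFinset_le {α : Type*} (s : Finset α) (hs : s.Nonempty) (A : Set α)
    [DecidablePred (· ∈ A)] {r : ℝ} (h : ((s.filter (· ∈ A)).card : ℝ) ≤ r * s.card) :
    (uniformOfFinset s hs).toOuterMeasure A ≤ ENNReal.ofReal r := by
  have hc : (0 : ℝ) < s.card := by exact_mod_cast hs.card_pos
  rw [toOuterMeasure_uniformOfFinset_apply]
  refine ENNReal.div_le_of_le_mul ?_
  rw [← ENNReal.ofReal_natCast, ← ENNReal.ofReal_natCast s.card, ← ENNReal.ofReal_mul' hc.le]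
  convert ENNReal.ofReal_le_ofReal h

theorem card_filter_le_of_toOuterMeasure_le {α : Type*} (s : Finset α) (hs : s.Nonempty)
    (A : Set α) [DecidablePred (· ∈ A)] {r : ℝ} (hr : 0 ≤ r)
    (h : (uniformOfFinset s hs).toOuterMeasure A ≤ ENNReal.ofReal r) :
    ((s.filter (· ∈ A)).card : ℝ) ≤ r * s.card := by
  have hc : (0 : ℝ) < s.card := by exact_mod_cast hs.card_pos
  rw [toOuterMeasure_uniformOfFinset_apply, ENNReal.div_le_iff_le_mul
    (Or.inl (by exact_mod_cast hs.card_pos.ne')) (Or.inl (ENNReal.natCast_ne_top _)),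
    ← ENNReal.ofReal_natCast, ← ENNReal.ofReal_natCast s.card, ← ENNReal.ofReal_mul hr] at h
  convert (ENNReal.ofReal_le_ofReal_iff (by positivity)).1 h

theorem toOuterMeasure_univ {α : Type*} (p : PMF α) : p.toOuterMeasure Set.univ = 1 := by
  rw [toOuterMeasure_apply_eq_one_iff]
  exact Set.subset_univ _

theorem toOuterMeasure_le_one {α : Type*} (p : PMF α) (A : Set α) : p.toOuterMeasure A ≤ 1 := by
  rw [← p.toOuterMeasure_univ]
  exact p.toOuterMeasure.mono (Set.subset_univ _)

/-- The failure probability of a sequential composition. -/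
theorem toOuterMeasure_bind_le {α β : Type*} (p : PMF α) (q : α → PMF β) (A : Set α) (B : Set β)
    {r : ENNReal} (h : ∀ a ∉ A, (q a).toOuterMeasure B ≤ r) :
    (p.bind q).toOuterMeasure B ≤ p.toOuterMeasure A + r := by
  rw [toOuterMeasure_bind_apply, toOuterMeasure_apply]
  calc ∑' a, p a * (q a).toOuterMeasure B ≤ ∑' a, (A.indicator p a + p a * r) := by
        refine ENNReal.tsum_le_tsum fun a => ?_
        by_cases ha : a ∈ A
        · rw [Set.indicator_of_mem ha]
          calc p a * (q a).toOuterMeasure B ≤ p a * 1 := by gcongr; exact toOuterMeasure_le_one _ _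
            _ ≤ _ := by rw [mul_one]; exact le_self_add
        · rw [Set.indicator_of_notMem ha, zero_add]
          gcongr
          exact h a ha
    _ = _ := by rw [ENNReal.tsum_add, ENNReal.tsum_mul_right, p.tsum_coe, one_mul]

end PMF

section Batches

variable {d n : ℕ}

theorem card_of_mem_batches {S : Dataset d n} {b : ℕ} {ℓ : Leaf d} {B : Finset (Fin n)}
    (hB : B ∈ batches S b ℓ) :
    B ⊆ consistentExamples S ℓ ∧ B.card = min b (consistentExamples S ℓ).card :=
  Finset.mem_powersetCard.1 hB

/-- The fraction of the indices in `B` that lie in `Q`. -/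
noncomputable def freq (B Q : Finset (Fin n)) : ℝ := ((B ∩ Q).card : ℝ) / B.card

theorem toOuterMeasure_batch_deviation_le (S : Dataset d n) {b : ℕ} (hb : 0 < b) (ℓ : Leaf d)
    (Q : Finset (Fin n)) {τ : ℝ} (h0 : 0 ≤ τ) (h1 : τ ≤ 1) :
    (PMF.uniformOfFinset (batches S b ℓ) (batches_nonempty S b ℓ)).toOuterMeasure
      {B | ¬ |freq B Q - freq (consistentExamples S ℓ) Q| ≤ τ} ≤
      ENNReal.ofReal (2 * Real.exp (-(b * τ ^ 2 / 4))) := by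
  apply PMF.toOuterMeasure_uniformOfFinset_le
  rcases le_or_gt (consistentExamples S ℓ).card b with hle | hlt
  · rw [Finset.filter_false_of_mem, Finset.card_empty]
    · push_cast; positivity
    · intro B hB hbad
      obtain ⟨h2, h3⟩ := card_of_mem_batches hB
      rw [min_eq_right hle] at h3
      have e : B = consistentExamples S ℓ := Finset.eq_of_subset_of_card_le h2 h3.ge
      rw [Set.mem_ofPred_eq, e, sub_self, abs_zero] at hbad
      exact hbad h0
  · have hmin : min b (consistentExamples S ℓ).card = b := min_eq_left hlt.le
    have key := card_powersetCard_deviation_le (consistentExamples S ℓ)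
      (consistentExamples S ℓ ∩ Q) Finset.inter_subset_left (b := b) (by omega) h0 h1
    unfold batches
    rw [hmin]
    refine le_trans ?_ key
    have hb' : (0 : ℝ) < b := by exact_mod_cast hb
    gcongr with B hB
    intro hbad
    obtain ⟨h2, h3⟩ := Finset.mem_powersetCard.1 hB
    rw [Set.mem_ofPred_eq, not_le] at hbad
    have e : B ∩ (consistentExamples S ℓ ∩ Q) = B ∩ Q := by
      rw [← Finset.inter_assoc, Finset.inter_eq_left.2 h2]
    rw [e]
    have e2 : ((B ∩ Q).card : ℝ) -
        ((consistentExamples S ℓ ∩ Q).card : ℝ) / (consistentExamples S ℓ).card * b =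
        (freq B Q - freq (consistentExamples S ℓ) Q) * b := by
      unfold freq
      rw [h3]
      field_simp
    rw [e2, abs_mul, abs_of_pos hb']
    gcongr

/-- The union bound over independently drawn minibatches. -/
theorem toOuterMeasure_drawBatches_le (S : Dataset d n) (b : ℕ) (A : Finset (Leaf d))
    (bad : Leaf d → Set (Finset (Fin n))) {r : ℝ} (hr : 0 ≤ r)
    (h : ∀ ℓ ∈ A, (PMF.uniformOfFinset (batches S b ℓ) (batches_nonempty S b ℓ)).toOuterMeasure
      (bad ℓ) ≤ ENNReal.ofReal r) :
    (drawBatches S b A).toOuterMeasure {B | ∃ ℓ, B ℓ ∈ bad ℓ.1} ≤ ENNReal.ofReal (A.card * r) := by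
  have hset : {B : {ℓ : Leaf d // ℓ ∈ A} → Finset (Fin n) | ∃ ℓ, B ℓ ∈ bad ℓ.1} =
      ⋃ ℓ, {B | B ℓ ∈ bad ℓ.1} := by ext; simp
  rw [hset]
  refine (MeasureTheory.measure_iUnion_fintype_le _ _).trans ?_
  have key : ∀ ℓ : {ℓ : Leaf d // ℓ ∈ A},
      (drawBatches S b A).toOuterMeasure {B | B ℓ ∈ bad ℓ.1} ≤ ENNReal.ofReal r := by
    intro ℓ
    apply PMF.toOuterMeasure_uniformOfFinset_le
    have h1 := PMF.card_filter_le_of_toOuterMeasure_le _ _ _ hr (h ℓ.1 ℓ.2)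
    have e : (Fintype.piFinset fun ℓ : {ℓ : Leaf d // ℓ ∈ A} => batches S b ℓ.1).filter
        (· ∈ {B | B ℓ ∈ bad ℓ.1}) =
        Fintype.piFinset (Function.update (fun ℓ : {ℓ : Leaf d // ℓ ∈ A} => batches S b ℓ.1) ℓ
          ((batches S b ℓ.1).filter (· ∈ bad ℓ.1))) := by
      ext B
      simp only [Finset.mem_filter, Fintype.mem_piFinset, Set.mem_ofPred_eq]
      constructor
      · rintro ⟨h2, h3⟩ p
        by_cases hp : p = ℓ
        · subst hp; simp [h2 p, h3]
        · rw [Function.update_of_ne hp]; exact h2 p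
      · intro h2
        have h3 := h2 ℓ
        rw [Function.update_self, Finset.mem_filter] at h3
        refine ⟨fun p => ?_, h3.2⟩
        by_cases hp : p = ℓ
        · subst hp; exact h3.1
        · have := h2 p
          rwa [Function.update_of_ne hp] at this
    rw [e, Fintype.card_piFinset, Fintype.card_piFinset]
    have e2 : ∀ p, (Function.update (fun ℓ : {ℓ : Leaf d // ℓ ∈ A} => batches S b ℓ.1) ℓ
        ((batches S b ℓ.1).filter (· ∈ bad ℓ.1)) p).card =
        Function.update (fun p : {ℓ : Leaf d // ℓ ∈ A} => (batches S b p.1).card) ℓ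
          ((batches S b ℓ.1).filter (· ∈ bad ℓ.1)).card p := by
      intro p
      by_cases hp : p = ℓ
      · subst hp; simp
      · simp [Function.update_of_ne hp]
    simp_rw [e2]
    rw [Finset.prod_update_of_mem (Finset.mem_univ ℓ),
      ← Finset.mul_prod_erase _ (fun p : {ℓ : Leaf d // ℓ ∈ A} => (batches S b p.1).card)
        (Finset.mem_univ ℓ), Finset.sdiff_singleton_eq_erase]
    push_cast
    rw [← mul_assoc]
    gcongr
  refine (Finset.sum_le_sum fun ℓ _ => key ℓ).trans ?_
  rw [Finset.sum_const, nsmul_eq_mul, ENNReal.ofReal_mul (by positivity), ENNReal.ofReal_natCast]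
  simp

end Batches

end

section

open scoped Classical

variable {d n : ℕ}

theorem cubeAvg_indicator (P : Cube d → Prop) :
    cubeAvg (fun x => if P x then 1 else 0) =
      (Finset.univ.filter P).card / Fintype.card (Cube d) := by
  rw [cubeAvg, Finset.sum_boole]
  simp

/-- Uniform convergence over a finite family of events. -/
theorem toOuterMeasure_sample_deviation_le {W : Type*} [Fintype W] (P : W → Cube d → Prop) (n : ℕ)
    {γ : ℝ} (hγ0 : 0 ≤ γ) (hγ1 : γ ≤ 1) :
    (PMF.uniformOfFintype (Fin n → Cube d)).toOuterMeasure
      {xs | ∃ w, ¬ |((Finset.univ.filter fun k => P w (xs k)).card : ℝ) -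
        cubeAvg (fun x => if P w x then 1 else 0) * n| ≤ γ * n} ≤
      ENNReal.ofReal (Fintype.card W * (2 * Real.exp (-(n * γ ^ 2 / 4)))) := by
  have hset : {xs : Fin n → Cube d |
      ∃ w, ¬ |((Finset.univ.filter fun k => P w (xs k)).card : ℝ) -
        cubeAvg (fun x => if P w x then 1 else 0) * n| ≤ γ * n} =
      ⋃ w, {xs | ¬ |((Finset.univ.filter fun k => P w (xs k)).card : ℝ) -
        cubeAvg (fun x => if P w x then 1 else 0) * n| ≤ γ * n} := by ext; simp
  rw [hset]
  refine (MeasureTheory.measure_iUnion_fintype_le _ _).trans ?_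
  have key : ∀ w, (PMF.uniformOfFintype (Fin n → Cube d)).toOuterMeasure
      {xs | ¬ |((Finset.univ.filter fun k => P w (xs k)).card : ℝ) -
        cubeAvg (fun x => if P w x then 1 else 0) * n| ≤ γ * n} ≤
      ENNReal.ofReal (2 * Real.exp (-(n * γ ^ 2 / 4))) := by
    intro w
    apply PMF.toOuterMeasure_uniformOfFinset_le
    refine le_trans ?_ (card_sample_deviation_le n (P w) hγ0 hγ1)
    rw [Nat.cast_le]
    refine Finset.card_le_card fun xs hxs => ?_
    rw [Finset.mem_filter] at hxs ⊢
    refine ⟨Finset.mem_univ _, ?_⟩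
    have := hxs.2
    rw [Set.mem_ofPred_eq, not_le, cubeAvg_indicator] at this
    exact this.le
  refine (Finset.sum_le_sum fun w _ => key w).trans ?_
  rw [Finset.sum_const, nsmul_eq_mul, ENNReal.ofReal_mul (p := (Fintype.card W : ℝ)) (by positivity),
    ENNReal.ofReal_natCast, Finset.card_univ]

/-- The examples at the points `xs`, labelled by `f`. -/
def labelled (f : Cube d → Bool) (xs : Fin n → Cube d) : Dataset d n := fun k => (xs k, f (xs k))

/-- The frequencies of short conjunctions, alone and together with `f`, are close to their
probabilities. -/
def LeafAccurate (f : Cube d → Bool) (H : ℕ) (τ : ℝ) (xs : Fin n → Cube d) : Prop :=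
  ∀ ℓ : Leaf d, ℓ.length ≤ H → ∀ y : Bool,
    |((Finset.univ.filter fun k => Consistent ℓ (xs k) ∧ (y = true → f (xs k) = true)).card : ℝ) -
      cubeAvg (fun x => if Consistent ℓ x ∧ (y = true → f x = true) then 1 else 0) * n| ≤ τ * n

theorem toOuterMeasure_not_leafAccurate_le (f : Cube d → Bool) (H n : ℕ) {τ : ℝ} (h0 : 0 ≤ τ)
    (h1 : τ ≤ 1) :
    (PMF.uniformOfFintype (Fin n → Cube d)).toOuterMeasure {xs | ¬ LeafAccurate f H τ xs} ≤
      ENNReal.ofReal ((2 * d + 1) ^ H * 2 * (2 * Real.exp (-(n * τ ^ 2 / 4)))) := by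
  have key := toOuterMeasure_sample_deviation_le (d := d)
    (W := (Fin H → Option (Fin d × Bool)) × Bool)
    (fun w x => (∀ k q, w.1 k = some q → x q.1 = q.2) ∧ (w.2 = true → f x = true)) n h0 h1
  have hcard : (Fintype.card ((Fin H → Option (Fin d × Bool)) × Bool) : ℝ) =
      (2 * d + 1) ^ H * 2 := by
    simp [mul_comm]
  rw [hcard] at key
  refine le_trans ((PMF.uniformOfFintype (Fin n → Cube d)).toOuterMeasure.mono ?_) key
  intro xs hxs
  rw [Set.mem_ofPred_eq] at hxs ⊢
  contrapose! hxs
  intro ℓ hℓ y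
  have e : ∀ x : Cube d, Consistent ℓ x ↔
      ∀ (k : Fin H) (q : Fin d × Bool), ℓ[(k : ℕ)]? = some q → x q.1 = q.2 := by
    intro x
    constructor
    · intro h k q hq
      exact h q (List.mem_of_getElem? hq)
    · intro h q hq
      obtain ⟨k, hk, rfl⟩ := List.getElem_of_mem hq
      exact h ⟨k, by omega⟩ _ (List.getElem?_eq_getElem hk)
  have := hxs (fun k => ℓ[(k : ℕ)]?, y)
  simp only [e]
  convert this

namespace DecisionTree

/-- The preorder traversal of a tree. -/
def encode : DecisionTree d Bool → List (Fin d ⊕ Bool)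
  | leaf a => [Sum.inr a]
  | node i lo hi => Sum.inl i :: (lo.encode ++ hi.encode)

/-- One step of the reconstruction of a tree from its preorder traversal, read from the right. -/
def decodeStep : Fin d ⊕ Bool → List (DecisionTree d Bool) → List (DecisionTree d Bool)
  | Sum.inr a, st => leaf a :: st
  | Sum.inl i, lo :: hi :: st => node i lo hi :: st
  | Sum.inl _, st => st

theorem foldr_decodeStep_encode (T : DecisionTree d Bool) (st : List (DecisionTree d Bool)) :
    T.encode.foldr decodeStep st = T :: st := by
  induction T generalizing st with
  | leaf a => rfl
  | node i lo hi h1 h2 => simp [encode, h1, h2, decodeStep]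

theorem length_encode (T : DecisionTree d Bool) : T.encode.length + 1 = 2 * T.size := by
  induction T with
  | leaf a => rfl
  | node i lo hi h1 h2 =>
    simp only [encode, size, List.length_cons, List.length_append]
    omega

theorem size_complete (T : PartialTree d) (lab : Leaf d → Bool) :
    (T.complete lab).size = T.size := by
  induction T generalizing lab with
  | leaf a => rfl
  | node i lo hi h1 h2 => simp [complete, size, h1, h2]

end DecisionTree

/-- The empirical errors of the trees of size `t` are close to their errors. -/
def TreeAccurate (f : Cube d → Bool) (t : ℕ) (ζ : ℝ) (xs : Fin n → Cube d) : Prop :=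
  ∀ U : DecisionTree d Bool, U.size = t →
    |((Finset.univ.filter fun k => f (xs k) ≠ U.eval (xs k)).card : ℝ) - treeError f U * n| ≤ ζ * n

theorem toOuterMeasure_not_treeAccurate_le (f : Cube d → Bool) (t n : ℕ) {ζ : ℝ} (h0 : 0 ≤ ζ)
    (h1 : ζ ≤ 1) :
    (PMF.uniformOfFintype (Fin n → Cube d)).toOuterMeasure {xs | ¬ TreeAccurate f t ζ xs} ≤
      ENNReal.ofReal ((d + 2) ^ (2 * t - 1) * (2 * Real.exp (-(n * ζ ^ 2 / 4)))) := by
  have key := toOuterMeasure_sample_deviation_le (d := d) (W := Fin (2 * t - 1) → Fin d ⊕ Bool)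
    (fun w x => f x ≠
      (((List.ofFn w).foldr DecisionTree.decodeStep []).headD (.leaf false)).eval x) n h0 h1
  have hcard : (Fintype.card (Fin (2 * t - 1) → Fin d ⊕ Bool) : ℝ) = (d + 2) ^ (2 * t - 1) := by
    simp
  rw [hcard] at key
  refine le_trans ((PMF.uniformOfFintype (Fin n → Cube d)).toOuterMeasure.mono ?_) key
  intro xs hxs
  rw [Set.mem_ofPred_eq] at hxs ⊢
  contrapose! hxs
  intro U hU
  have hlen : U.encode.length = 2 * t - 1 := by
    have := U.length_encode
    omega
  obtain ⟨w, hw⟩ : ∃ w : Fin (2 * t - 1) → Fin d ⊕ Bool, List.ofFn w = U.encode := by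
    rw [← hlen]
    exact ⟨U.encode.get, List.ofFn_get _⟩
  have := hxs w
  rw [hw, DecisionTree.foldr_decodeStep_encode] at this
  rw [treeError_eq]
  convert this <;> rfl

/-- The examples that satisfy the literal `o` (if there is one) and are positive (if `y` holds). -/
noncomputable def literalExamples (S : Dataset d n) (o : Option (Fin d × Bool)) (y : Bool) :
    Finset (Fin n) :=
  Finset.univ.filter fun k =>
    (∀ q, o = some q → (S k).1 q.1 = q.2) ∧ (y = true → (S k).2 = true)

theorem mem_literalExamples (S : Dataset d n) (o : Option (Fin d × Bool)) (y : Bool) (k : Fin n) :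
    k ∈ literalExamples S o y ↔
      (∀ q, o = some q → (S k).1 q.1 = q.2) ∧ (y = true → (S k).2 = true) := by
  simp [literalExamples]

theorem mem_consistentExamples (S : Dataset d n) (ℓ : Leaf d) (k : Fin n) :
    k ∈ consistentExamples S ℓ ↔ Consistent ℓ (S k).1 := by
  simp [consistentExamples]

/-- The minibatch `B` represents the examples at `ℓ` up to `τ`. -/
def Representative (S : Dataset d n) (b : ℕ) (τ : ℝ) (ℓ : Leaf d) (B : Finset (Fin n)) : Prop :=
  B ∈ batches S b ℓ ∧ ∀ o y, |freq B (literalExamples S o y) -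
    freq (consistentExamples S ℓ) (literalExamples S o y)| ≤ τ

theorem toOuterMeasure_not_representative_le (S : Dataset d n) {b : ℕ} (hb : 0 < b) (ℓ : Leaf d)
    {τ : ℝ} (h0 : 0 ≤ τ) (h1 : τ ≤ 1) :
    (PMF.uniformOfFinset (batches S b ℓ) (batches_nonempty S b ℓ)).toOuterMeasure
      {B | ¬ Representative S b τ ℓ B} ≤
      ENNReal.ofReal ((2 * d + 1) * 2 * (2 * Real.exp (-(b * τ ^ 2 / 4)))) := by
  set p := PMF.uniformOfFinset (batches S b ℓ) (batches_nonempty S b ℓ)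
  have hsub : {B | ¬ Representative S b τ ℓ B} ⊆ {B | B ∉ batches S b ℓ} ∪
      ⋃ w : Option (Fin d × Bool) × Bool, {B | ¬ |freq B (literalExamples S w.1 w.2) -
        freq (consistentExamples S ℓ) (literalExamples S w.1 w.2)| ≤ τ} := by
    intro B hB
    rw [Set.mem_ofPred_eq, Representative, not_and_or] at hB
    rcases hB with h | h
    · exact Or.inl h
    · right
      simp only [not_forall] at h
      obtain ⟨o, y, h⟩ := h
      exact Set.mem_iUnion.2 ⟨(o, y), h⟩
  have hz : p.toOuterMeasure {B | B ∉ batches S b ℓ} ≤ ENNReal.ofReal 0 := by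
    apply PMF.toOuterMeasure_uniformOfFinset_le
    rw [Finset.filter_false_of_mem (fun B hB h => h hB)]
    simp
  refine (p.toOuterMeasure.mono hsub).trans ?_
  refine (MeasureTheory.measure_union_le (μ := p.toOuterMeasure) _ _).trans ?_
  rw [ENNReal.ofReal_zero, nonpos_iff_eq_zero] at hz
  rw [hz, zero_add]
  refine (MeasureTheory.measure_iUnion_fintype_le _ _).trans ?_
  refine (Finset.sum_le_sum fun w _ => toOuterMeasure_batch_deviation_le S hb ℓ _ h0 h1).trans ?_
  rw [Finset.sum_const, nsmul_eq_mul, ← ENNReal.ofReal_natCast, ← ENNReal.ofReal_mul (by positivity)]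
  apply le_of_eq
  congr 2
  simp
  ring

theorem meanLabel_eq_freq (S : Dataset d n) (B : Finset (Fin n)) :
    meanLabel S B = freq B (literalExamples S none true) := by
  rw [meanLabel, freq, Finset.sum_boole]
  congr 3
  ext k
  simp [literalExamples]

theorem side_eq_inter (S : Dataset d n) (B : Finset (Fin n)) (i : Fin d) (v : Bool) :
    side S B i v = B ∩ literalExamples S (some (i, v)) false := by
  ext k
  simp [side, literalExamples]

theorem meanLabel_side_eq (S : Dataset d n) (B : Finset (Fin n)) (i : Fin d) (v : Bool) :
    meanLabel S (side S B i v) = freq B (literalExamples S (some (i, v)) true) /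
      freq B (literalExamples S (some (i, v)) false) := by
  rw [meanLabel_eq_freq, freq, freq, freq, side_eq_inter]
  rcases B.eq_empty_or_nonempty with rfl | hB
  · simp
  have hB : (B.card : ℝ) ≠ 0 := by exact_mod_cast hB.card_pos.ne'
  rw [div_div_div_cancel_right₀ hB]
  congr 3
  ext k
  simp [literalExamples]

theorem meanLabel_mem (S : Dataset d n) (B : Finset (Fin n)) :
    meanLabel S B ∈ Set.Icc (0 : ℝ) 1 := by
  rw [meanLabel_eq_freq, freq]
  constructor
  · positivity
  · apply div_le_one_of_le₀ _ (by positivity)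
    exact_mod_cast Finset.card_le_card Finset.inter_subset_left

theorem localGain_le_one {G : ℝ → ℝ} (hG : IsImpurity G) (S : Dataset d n) (B : Finset (Fin n))
    (i : Fin d) : localGain G S B i ≤ 1 := by
  unfold localGain
  split_ifs
  · have h0 := (hG.mapsTo (meanLabel_mem S B)).2
    have h1 := (hG.mapsTo (meanLabel_mem S (side S B i false))).1
    have h2 := (hG.mapsTo (meanLabel_mem S (side S B i true))).1
    linarith
  · exact zero_le_one

theorem localGain_eq_zero_of_mem (G : ℝ → ℝ) (S : Dataset d n) {B : Finset (Fin n)} {ℓ : Leaf d}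
    (hB : B ⊆ consistentExamples S ℓ) {i : Fin d} (hi : i ∈ ℓ.map Prod.fst) :
    localGain G S B i = 0 := by
  obtain ⟨q, hq, rfl⟩ := List.mem_map.1 hi
  have h : ∀ k ∈ B, (S k).1 q.1 = q.2 := fun k hk =>
    (Finset.mem_filter.1 (hB hk)).2 q hq
  have he : side S B q.1 (!q.2) = ∅ := by
    unfold side
    rw [Finset.filter_eq_empty_iff]
    intro k hk
    rw [h k hk]
    cases q.2 <;> simp
  unfold localGain
  rw [if_neg]
  rintro ⟨h1, h2⟩
  cases hv : q.2
  · rw [hv, Bool.not_false] at he; exact h2.ne_empty he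
  · rw [hv, Bool.not_true] at he; exact h1.ne_empty he

theorem abs_div_sub_le {N a w p n τ τ' : ℝ} (hn : 0 < n) (hw : 0 < w) (hp0 : 0 ≤ p) (hp1 : p ≤ 1)
    (hτ1 : τ ≤ 1) (hτ0 : 0 ≤ τ) (hτ' : τ' ≤ w * τ / 4) (hN : |N - w * n| ≤ τ' * n)
    (ha : |a - w * p * n| ≤ τ' * n) : 0 < N ∧ |a / N - p| ≤ τ := by
  have h1 : τ' * n ≤ w * n * τ / 4 := by nlinarith
  have hwn : 0 < w * n := by positivity
  rw [abs_le] at hN ha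
  have hN0 : w * n / 2 ≤ N := by nlinarith
  have hNpos : 0 < N := by linarith
  refine ⟨hNpos, ?_⟩
  have e : a / N - p = (a - p * N) / N := by field_simp
  rw [e, abs_div, abs_of_pos hNpos, div_le_iff₀ hNpos, abs_le]
  have h2 : w * n * τ / 2 ≤ τ * N := by nlinarith
  have h3 : p * (τ' * n) ≤ τ' * n := by
    have : 0 ≤ τ' * n := by linarith
    nlinarith
  constructor <;> nlinarith [mul_le_mul_of_nonneg_left hN.1 hp0, mul_le_mul_of_nonneg_left hN.2 hp0]

theorem cubeAvg_consistent_indicator {ℓ : Leaf d} (hℓ : ℓ.Irredundant) (f : Cube d → Bool)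
    (y : Bool) :
    cubeAvg (fun x => if Consistent ℓ x ∧ (y = true → f x = true) then 1 else 0) =
      (1 / 2) ^ ℓ.length * if y = true then leafMean f ℓ else 1 := by
  have e : ∀ x, (if Consistent ℓ x ∧ (y = true → f x = true) then (1 : ℝ) else 0) =
      if Consistent ℓ x then (if y = true then bitVal (f x) else 1) else 0 := by
    intro x
    cases y <;> by_cases h : Consistent ℓ x <;> simp [h, bitVal]
  simp_rw [e]
  rw [cubeAvg_consistent ℓ hℓ]
  congr 1
  cases y
  · simp only [Bool.false_eq_true, if_false]
    rw [fixLeaf_comp (fun _ => (1 : ℝ)) ℓ f, cubeAvg_const]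
  · simp only [if_true]
    rw [fixLeaf_comp bitVal ℓ f]
    rfl

/-- Accurate samples estimate the conditional probabilities at shallow leaves. -/
theorem LeafAccurate.freq_sub_le {f : Cube d → Bool} {xs : Fin n → Cube d} {H : ℕ} {τ τ' : ℝ}
    (h : LeafAccurate f H τ' xs) (hn : 0 < n) (hτ0 : 0 ≤ τ) (hτ1 : τ ≤ 1) {ℓ ℓ' : Leaf d}
    (hℓ : ℓ.Irredundant) (hℓ' : ℓ'.Irredundant) (hlen : ℓ.length ≤ H) (hlen' : ℓ'.length ≤ H)
    (hle : ℓ.length ≤ ℓ'.length) (hτ' : τ' ≤ (1 / 2) ^ ℓ.length * τ / 4)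
    (o : Option (Fin d × Bool)) (y : Bool)
    (ho : ∀ x, Consistent ℓ' x ↔ Consistent ℓ x ∧ ∀ q, o = some q → x q.1 = q.2) :
    0 < (consistentExamples (labelled f xs) ℓ).card ∧
    |freq (consistentExamples (labelled f xs) ℓ) (literalExamples (labelled f xs) o y) -
      (1 / 2) ^ (ℓ'.length - ℓ.length) * (if y = true then leafMean f ℓ' else 1)| ≤ τ := by
  have hn' : (0 : ℝ) < n := by exact_mod_cast hn
  have h1 := h ℓ hlen false
  have h2 := h ℓ' hlen' y
  rw [cubeAvg_consistent_indicator hℓ] at h1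
  rw [cubeAvg_consistent_indicator hℓ'] at h2
  have hw : (0 : ℝ) < (1 / 2) ^ ℓ.length := by positivity
  have hval : 0 ≤ (if y = true then leafMean f ℓ' else 1) ∧
      (if y = true then leafMean f ℓ' else 1) ≤ 1 := by
    split_ifs
    · exact leafMean_mem f ℓ'
    · norm_num
  have hpow : (1 / 2 : ℝ) ^ ℓ'.length = (1 / 2) ^ ℓ.length * (1 / 2) ^ (ℓ'.length - ℓ.length) := by
    rw [← pow_add]; congr 1; omega
  have hpow1 : (1 / 2 : ℝ) ^ (ℓ'.length - ℓ.length) ≤ 1 := pow_le_one₀ (by norm_num) (by norm_num)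
  rw [hpow, mul_assoc ((1 / 2 : ℝ) ^ ℓ.length)] at h2
  simp only [Bool.false_eq_true, if_false, mul_one, false_imp_iff, and_true] at h1
  have := abs_div_sub_le hn' hw (p := (1 / 2) ^ (ℓ'.length - ℓ.length) *
    (if y = true then leafMean f ℓ' else 1)) (mul_nonneg (by positivity) hval.1)
    (mul_le_one₀ hpow1 hval.1 hval.2) hτ1 hτ0 hτ' h1 h2
  refine ⟨by exact_mod_cast this.1, ?_⟩
  have e : consistentExamples (labelled f xs) ℓ ∩ literalExamples (labelled f xs) o y =
      Finset.univ.filter fun k => Consistent ℓ' (xs k) ∧ (y = true → f (xs k) = true) := by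
    ext k
    simp only [mem_consistentExamples, mem_literalExamples, labelled, Finset.mem_inter,
      Finset.mem_filter, Finset.mem_univ, true_and, ho, and_assoc]
  rw [freq, e]
  exact this.2

theorem abs_quotient_sub_le {a β p τ : ℝ} (hp0 : 0 ≤ p) (hp1 : p ≤ 1) (hτ0 : 0 ≤ τ)
    (hτ1 : τ ≤ 1 / 16) (hβ : |β - 1 / 2| ≤ 2 * τ) (ha : |a - 1 / 2 * p| ≤ 2 * τ) :
    0 < β ∧ |a / β - p| ≤ 16 * τ := by
  rw [abs_le] at hβ ha
  have hβ0 : 3 / 8 ≤ β := by linarith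
  refine ⟨by linarith, ?_⟩
  have e : a / β - p = (a - p * β) / β := by field_simp
  rw [e, abs_div, abs_of_pos (by linarith : 0 < β), div_le_iff₀ (by linarith), abs_le]
  have h3 : p * (2 * τ) ≤ 2 * τ := by nlinarith
  constructor <;> nlinarith [mul_le_mul_of_nonneg_left hβ.1 hp0, mul_le_mul_of_nonneg_left hβ.2 hp0]

/-- Representative minibatches of accurate samples estimate the gains at shallow leaves. -/
theorem LeafAccurate.abs_localGain_sub_le {f : Cube d → Bool} {xs : Fin n → Cube d} {m : ℕ}
    {τ C α η : ℝ} {G : ℝ → ℝ} (hC : 0 < C) (hα : 0 < α) (hG : IsHolder C α G)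
    (h : LeafAccurate f (2 * m + 1) ((1 / 2) ^ (2 * m) * τ / 4) xs) (hn : 0 < n) {b : ℕ}
    (hb : 0 < b) (hτ0 : 0 ≤ τ) (hτ1 : τ ≤ 1 / 16) (hη : 2 * (C * (16 * τ) ^ α) ≤ η)
    {ℓ : Leaf d} (hℓ : ℓ.Irredundant) (hlen : ℓ.length ≤ 2 * m) {B : Finset (Fin n)}
    (hB : Representative (labelled f xs) b τ ℓ B) (i : Fin d) :
    |localGain G (labelled f xs) B i - exactGain G f ℓ i| ≤ η := by
  have hBsub := (card_of_mem_batches hB.1).1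
  have hη0 : 0 ≤ η := le_trans (by positivity) hη
  by_cases hi : i ∈ ℓ.map Prod.fst
  · rw [localGain_eq_zero_of_mem G _ hBsub hi, exactGain_of_mem hi, sub_zero, abs_zero]
    exact hη0
  have hpow : (1 / 2 : ℝ) ^ (2 * m) ≤ (1 / 2) ^ ℓ.length :=
    pow_le_pow_of_le_one (by norm_num) (by norm_num) hlen
  have hτ' : (1 / 2 : ℝ) ^ (2 * m) * τ / 4 ≤ (1 / 2) ^ ℓ.length * τ / 4 := by gcongr
  have hirr : ∀ v, Leaf.Irredundant (ℓ ++ [(i, v)]) := by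
    intro v
    unfold Leaf.Irredundant at hℓ ⊢
    rw [List.map_append, List.nodup_append]
    refine ⟨hℓ, by simp, ?_⟩
    intro a ha b hb hab
    simp only [List.map_cons, List.map_nil, List.mem_singleton] at hb
    exact hi (by rw [← hb, ← hab]; exact ha)
  have close : ∀ {p q r : ℝ}, |p - q| ≤ τ → |q - r| ≤ τ → |p - r| ≤ 2 * τ := by
    intro p q r h1 h2
    have := abs_sub_le p q r
    linarith
  obtain ⟨hpos, h0⟩ := h.freq_sub_le hn hτ0 (by linarith) hℓ hℓ (by omega) (by omega) le_rfl hτ'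
    none true (by simp)
  have hBpos : (0 : ℝ) < B.card := by
    have := (card_of_mem_batches hB.1).2
    have h : 0 < B.card := by rw [this]; exact lt_min hb hpos
    exact_mod_cast h
  have hside : ∀ v, (side (labelled f xs) B i v).Nonempty ∧
      |meanLabel (labelled f xs) (side (labelled f xs) B i v) - leafMean f (ℓ ++ [(i, v)])| ≤
        16 * τ := by
    intro v
    have hcons : ∀ x : Cube d, Consistent (ℓ ++ [(i, v)]) x ↔
        Consistent ℓ x ∧ ∀ q, some (i, v) = some q → x q.1 = q.2 := by
      intro x; simp [consistent_append]
    have hl : (ℓ ++ [(i, v)]).length = ℓ.length + 1 := by simp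
    have h1 := (h.freq_sub_le hn hτ0 (by linarith) hℓ (hirr v) (by omega) (by omega) (by omega) hτ'
      (some (i, v)) true hcons).2
    have h2 := (h.freq_sub_le hn hτ0 (by linarith) hℓ (hirr v) (by omega) (by omega) (by omega) hτ'
      (some (i, v)) false hcons).2
    rw [hl, Nat.add_sub_cancel_left, pow_one] at h1 h2
    simp only [if_true, Bool.false_eq_true, if_false, mul_one] at h1 h2
    have h3 := close (hB.2 (some (i, v)) true) h1
    have h4 := close (hB.2 (some (i, v)) false) h2
    obtain ⟨h5, h6⟩ := abs_quotient_sub_le (leafMean_mem f _).1 (leafMean_mem f _).2 hτ0 hτ1 h4 h3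
    rw [meanLabel_side_eq]
    refine ⟨?_, h6⟩
    rw [side_eq_inter, ← Finset.card_pos]
    by_contra hc
    rw [freq, Nat.eq_zero_of_not_pos hc] at h5
    simp at h5
  have hmean : |meanLabel (labelled f xs) B - leafMean f ℓ| ≤ 16 * τ := by
    rw [Nat.sub_self, pow_zero, one_mul] at h0
    simp only [if_true] at h0
    rw [meanLabel_eq_freq]
    have := close (hB.2 none true) h0
    linarith
  have hold : ∀ {p q : ℝ}, p ∈ Set.Icc (0 : ℝ) 1 → q ∈ Set.Icc (0 : ℝ) 1 → |p - q| ≤ 16 * τ →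
      |G p - G q| ≤ C * (16 * τ) ^ α := by
    intro p q hp hq hpq
    refine (hG p hp q hq).trans ?_
    gcongr
  have g0 := hold (meanLabel_mem _ _) (leafMean_mem f _) hmean
  have g1 := hold (meanLabel_mem _ _) (leafMean_mem f _) (hside false).2
  have g2 := hold (meanLabel_mem _ _) (leafMean_mem f _) (hside true).2
  rw [localGain, if_pos ⟨(hside false).1, (hside true).1⟩, exactGain]
  rw [abs_le] at *
  constructor <;> linarith

/-- Labelling by majorities of representative minibatches is almost as good, on the sample, as any
other labelling. -/
theorem card_errors_complete_le (f : Cube d → Bool) (xs : Fin n → Cube d) {b : ℕ} {τ : ℝ}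
    (T : PartialTree d) (B : {ℓ : Leaf d // ℓ ∈ T.leaves} → Finset (Fin n))
    (hB : ∀ ℓ, Representative (labelled f xs) b τ ℓ.1 (B ℓ)) (lab : Leaf d → Bool) :
    ((Finset.univ.filter fun k => f (xs k) ≠ (T.complete fun ℓ =>
      if h : ℓ ∈ T.leaves then decide (1 / 2 ≤ meanLabel (labelled f xs) (B ⟨ℓ, h⟩))
        else false).eval (xs k)).card : ℝ) ≤
      (Finset.univ.filter fun k => f (xs k) ≠ (T.complete lab).eval (xs k)).card + 2 * τ * n := by
  have key : ∀ lab : Leaf d → Bool,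
      ((Finset.univ.filter fun k => f (xs k) ≠ (T.complete lab).eval (xs k)).card : ℝ) =
      ∑ ℓ ∈ T.leaves, ∑ k, if Consistent ℓ (xs k) then (if f (xs k) ≠ lab ℓ then (1 : ℝ) else 0)
        else 0 := by
    intro lab
    rw [Finset.sum_comm, ← Finset.sum_boole]
    exact Finset.sum_congr rfl fun k _ =>
      (T.sum_consistent_leaves lab (fun b => if f (xs k) ≠ b then (1 : ℝ) else 0) (xs k)).symm
  have hn : (n : ℝ) = ∑ ℓ ∈ T.leaves, ((consistentExamples (labelled f xs) ℓ).card : ℝ) := by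
    have : ∀ k : Fin n, (1 : ℝ) = ∑ ℓ ∈ T.leaves, if Consistent ℓ (xs k) then (1 : ℝ) else 0 :=
      fun k => (T.sum_consistent_leaves (fun _ => true) (fun _ => 1) (xs k)).symm
    have h2 : (n : ℝ) = ∑ k : Fin n, (1 : ℝ) := by simp
    rw [h2, Finset.sum_congr rfl fun k _ => this k, Finset.sum_comm]
    refine Finset.sum_congr rfl fun ℓ _ => ?_
    rw [Finset.sum_boole]
    rfl
  rw [key, key, hn, Finset.mul_sum, ← Finset.sum_add_distrib]
  refine Finset.sum_le_sum fun ℓ hℓ => ?_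
  rw [dif_pos hℓ]
  set N := ((consistentExamples (labelled f xs) ℓ).card : ℝ) with hN
  set Y := ((consistentExamples (labelled f xs) ℓ ∩
    literalExamples (labelled f xs) none true).card : ℝ) with hY
  have hYsum : Y = ∑ k, if Consistent ℓ (xs k) then bitVal (f (xs k)) else 0 := by
    have : ∀ k, (if Consistent ℓ (xs k) then bitVal (f (xs k)) else 0) =
        if Consistent ℓ (xs k) ∧ f (xs k) = true then (1 : ℝ) else 0 := by
      intro k
      unfold bitVal
      split_ifs <;> simp_all
    simp_rw [this]
    rw [Finset.sum_boole, hY]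
    congr 2
    ext k
    simp [mem_consistentExamples, mem_literalExamples, labelled]
  have hNsum : N = ∑ k, if Consistent ℓ (xs k) then (1 : ℝ) else 0 := by
    rw [Finset.sum_boole]; rfl
  have hlab : ∀ v : Bool, (∑ k, if Consistent ℓ (xs k) then (if f (xs k) ≠ v then (1 : ℝ) else 0)
      else 0) = if v = true then N - Y else Y := by
    intro v
    rw [hYsum, hNsum, ← Finset.sum_sub_distrib]
    cases v
    · simp only [Bool.false_eq_true, if_false]
      refine Finset.sum_congr rfl fun k _ => ?_
      cases f (xs k) <;> simp [bitVal]
    · simp only [if_true]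
      refine Finset.sum_congr rfl fun k _ => ?_
      by_cases hc : Consistent ℓ (xs k) <;> cases f (xs k) <;> simp [bitVal, hc]
  rw [hlab, hlab]
  have hfreq : Y = freq (consistentExamples (labelled f xs) ℓ)
      (literalExamples (labelled f xs) none true) * N := by
    rw [freq, ← hN, ← hY]
    rcases eq_or_ne N 0 with h0 | h0
    · have : Y ≤ N := by
        rw [hY, hN]
        exact_mod_cast Finset.card_le_card Finset.inter_subset_left
      have : 0 ≤ Y := by rw [hY]; positivity
      rw [h0, mul_zero]
      linarith
    · field_simp
  have hrep := abs_le.1 ((hB ⟨ℓ, hℓ⟩).2 none true)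
  rw [← meanLabel_eq_freq] at hrep
  have hN0 : 0 ≤ N := by rw [hN]; positivity
  have hτ0 : 0 ≤ τ := (abs_nonneg _).trans ((hB ⟨ℓ, hℓ⟩).2 none true)
  have hτN : 0 ≤ τ * N := mul_nonneg hτ0 hN0
  set φ := freq (consistentExamples (labelled f xs) ℓ)
      (literalExamples (labelled f xs) none true)
  by_cases hm : 1 / 2 ≤ meanLabel (labelled f xs) (B ⟨ℓ, hℓ⟩)
  · have : (1 / 2 - τ) * N ≤ φ * N := by gcongr; linarith
    simp only [hm, decide_true, if_true]
    cases lab ℓ <;> simp <;> linarith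
  · have : φ * N ≤ (1 / 2 + τ) * N := by gcongr; linarith
    simp only [hm, decide_false]
    cases lab ℓ <;> simp <;> linarith

end

section

open scoped Classical

variable {d n : ℕ}

theorem toOuterMeasure_growLoop_le (G : ℝ → ℝ)
    (tie : PartialTree d → Finset (Leaf d × Fin d) → Leaf d × Fin d) (t b : ℕ) (S : Dataset d n)
    (Inv : PartialTree d → Prop) {r : ENNReal}
    (hstep : ∀ T, Inv T → T.size < t →
      (growStep G tie t b S T).toOuterMeasure {T' | ¬ (T'.size = T.size + 1 ∧ Inv T')} ≤ r) :
    ∀ (k : ℕ) (T : PartialTree d), Inv T → T.size ≤ t → t ≤ T.size + k →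
      (growLoop G tie t b S k T).toOuterMeasure {T' | ¬ (T'.size = t ∧ Inv T')} ≤ k * r := by
  have hpure : ∀ T : PartialTree d, Inv T → T.size = t →
      (PMF.pure T).toOuterMeasure {T' | ¬ (T'.size = t ∧ Inv T')} = 0 := by
    intro T hT hs
    rw [PMF.toOuterMeasure_pure_apply, if_neg]
    exact fun h => h ⟨hs, hT⟩
  intro k
  induction k with
  | zero =>
    intro T hT h1 h2
    rw [growLoop, hpure T hT (by omega)]
    exact zero_le
  | succ k ih =>
    intro T hT h1 h2
    rw [growLoop]
    split_ifs with h
    · refine (PMF.toOuterMeasure_bind_le _ _ {T' | ¬ (T'.size = T.size + 1 ∧ Inv T')} _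
        (r := k * r) fun T' hT' => ?_).trans ?_
      · have hT' : T'.size = T.size + 1 ∧ Inv T' := not_not.1 hT'
        exact ih T' hT'.2 (by omega) (by omega)
      · rw [Nat.cast_succ, add_mul, one_mul, add_comm]
        gcongr
        exact hstep T hT h
    · rw [hpure T hT (by omega)]
      exact zero_le

theorem logb_nonneg_of_two_le {t : ℕ} (ht : 2 ≤ t) : 1 ≤ Real.logb 2 t := by
  rw [Real.le_logb_iff_rpow_le (by norm_num) (by positivity)]
  simpa using (by exact_mod_cast ht : (2 : ℝ) ≤ t)

theorem logb_le_depthBound {t : ℕ} (ht : 2 ≤ t) : Real.logb 2 t ≤ depthBound t :=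
  le_add_of_nonneg_right (Real.logb_nonneg (by norm_num) (logb_nonneg_of_two_le ht))

theorem splittableLeaves_nonempty {t : ℕ} (ht : 2 ≤ t) {T : PartialTree d} (hT : T.size ≤ t) :
    (splittableLeaves t T).Nonempty := by
  obtain ⟨ℓ, hℓ, hlen⟩ := T.exists_leaf_length_le
  refine ⟨ℓ, Finset.mem_filter.2 ⟨hℓ, hlen.trans (le_trans ?_ (logb_le_depthBound ht))⟩⟩
  exact Real.logb_le_logb_of_le (by norm_num) (by exact_mod_cast T.size_pos)
    (by exact_mod_cast hT)

theorem maximizers_nonempty (hd : 0 < d) (G : ℝ → ℝ) (S : Dataset d n) {A : Finset (Leaf d)}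
    (hA : A.Nonempty) (B : {ℓ : Leaf d // ℓ ∈ A} → Finset (Fin n)) :
    (maximizers G S A B).Nonempty := by
  obtain ⟨ℓ, hℓ⟩ := hA
  have : Nonempty ({ℓ : Leaf d // ℓ ∈ A} × Fin d) := ⟨(⟨ℓ, hℓ⟩, ⟨0, hd⟩)⟩
  obtain ⟨p, hp⟩ := Finite.exists_max fun p : {ℓ : Leaf d // ℓ ∈ A} × Fin d =>
    purityGain G S p.1.1 (B p.1) p.2
  exact ⟨_, Finset.mem_image_of_mem _ (Finset.mem_filter.2 ⟨Finset.mem_univ p, hp⟩)⟩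

theorem mem_maximizers {G : ℝ → ℝ} {S : Dataset d n} {A : Finset (Leaf d)}
    {B : {ℓ : Leaf d // ℓ ∈ A} → Finset (Fin n)} {p : Leaf d × Fin d}
    (hp : p ∈ maximizers G S A B) :
    ∃ h : p.1 ∈ A, ∀ (ℓ : Leaf d) (hℓ : ℓ ∈ A) (i : Fin d),
      (1 / 2) ^ ℓ.length * localGain G S (B ⟨ℓ, hℓ⟩) i ≤
        (1 / 2) ^ p.1.length * localGain G S (B ⟨p.1, h⟩) p.2 := by
  obtain ⟨⟨⟨ℓ, hℓ⟩, i⟩, hq, rfl⟩ := Finset.mem_image.1 hp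
  exact ⟨hℓ, fun ℓ' hℓ' i' => (Finset.mem_filter.1 hq).2 (⟨ℓ', hℓ'⟩, i')⟩

/-- The invariant of the growing phase: the tree is either good enough or still small and pure. -/
def GrowInvariant (G : ℝ → ℝ) (f : Cube d → Bool) (e η : ℝ) (m : ℕ) (T : PartialTree d) : Prop :=
  CompletableTo f e T ∨ T.size < 2 ^ m ∧ HasPurity G f η T

theorem toOuterMeasure_growStep_le {G : ℝ → ℝ} {κ C α ε : ℝ} (hd : 0 < d) (hκ : 0 < κ) (hC : 0 < C)
    (hα : 0 < α) (hε : 0 < ε) (hI : IsImpurity G) (hG : IsStronglyConcave κ G)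
    (hH : IsHolder C α G) {f : Cube d → Bool} (hf : IsMonotone f) {s : ℕ} (hs : 2 ≤ s) {m : ℕ}
    {η : ℝ} (hη : η = κ * ε ^ 2 / (8 * Real.logb 2 s ^ 2)) (hη0 : 0 < η)
    (hηm : (1 / 2) ^ m ≤ η / 4) (hm : 16 / 3 < η * m)
    {tie : PartialTree d → Finset (Leaf d × Fin d) → Leaf d × Fin d}
    (htie : ∀ T A, A.Nonempty → tie T A ∈ A) {t b : ℕ} (ht : 2 ≤ t)
    (hmt : ((2 * m : ℕ) : ℝ) ≤ depthBound t) (hb : 0 < b) (hn : 0 < n) {τ : ℝ} (hτ0 : 0 ≤ τ)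
    (hτ1 : τ ≤ 1 / 16) (hτη : 2 * (C * (16 * τ) ^ α) ≤ η / 16) {xs : Fin n → Cube d}
    (hxs : LeafAccurate f (2 * m + 1) ((1 / 2) ^ (2 * m) * τ / 4) xs) {T : PartialTree d}
    (hT : GrowInvariant G f (optError f s + ε / 2) η m T) (hTt : T.size < t) :
    (growStep G tie t b (labelled f xs) T).toOuterMeasure
      {T' | ¬ (T'.size = T.size + 1 ∧ GrowInvariant G f (optError f s + ε / 2) η m T')} ≤
      ENNReal.ofReal (t * ((2 * d + 1) * 2 * (2 * Real.exp (-(b * τ ^ 2 / 4))))) := by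
  have hAT : splittableLeaves t T ⊆ T.leaves := Finset.filter_subset _ _
  have hAcard : ((splittableLeaves t T).card : ℝ) ≤ t := by
    calc ((splittableLeaves t T).card : ℝ) ≤ T.leaves.card := by exact_mod_cast Finset.card_le_card hAT
      _ = T.size := T.card_leaves
      _ ≤ t := by exact_mod_cast hTt.le
  rw [growStep, PMF.toOuterMeasure_map_apply]
  have hdraw := toOuterMeasure_drawBatches_le (labelled f xs) b (splittableLeaves t T)
    (fun ℓ => {B | ¬ Representative (labelled f xs) b τ ℓ B}) (by positivity)
    fun ℓ _ => toOuterMeasure_not_representative_le (labelled f xs) hb ℓ hτ0 (by linarith)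
  refine (PMF.toOuterMeasure _).mono ?_ |>.trans (hdraw.trans (ENNReal.ofReal_le_ofReal ?_))
  swap
  · gcongr
  intro B hB
  by_contra hnot
  have hrep : ∀ ℓ : {ℓ // ℓ ∈ splittableLeaves t T},
      Representative (labelled f xs) b τ ℓ.1 (B ℓ) :=
    fun ℓ => by_contra fun h => hnot ⟨ℓ, h⟩
  apply hB
  have hne := maximizers_nonempty hd G (labelled f xs) (splittableLeaves_nonempty ht hTt.le) B
  have hp := htie T _ hne
  beta_reduce
  rw [if_pos hne]
  generalize tie T (maximizers G (labelled f xs) (splittableLeaves t T) B) = p at hp ⊢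
  obtain ⟨hpA, hmax⟩ := mem_maximizers hp
  refine ⟨DecisionTree.size_split _ _ _ (hAT hpA), ?_⟩
  by_cases hdone : CompletableTo f (optError f s + ε / 2) T
  · exact Or.inl (hdone.split _ (hAT hpA) _)
  · right
    obtain ⟨hlt, hpure⟩ := hT.resolve_left hdone
    have hAm : ∀ ℓ ∈ T.leaves, ℓ.length ≤ 2 * m → ℓ ∈ splittableLeaves t T := fun ℓ hℓ hlen =>
      Finset.mem_filter.2 ⟨hℓ, le_trans (by exact_mod_cast hlen) hmt⟩
    have key : HasPurity G f η (T.split p.1 p.2) := by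
      refine hpure.split hd hκ hε hI hG hf hs hη hηm hlt hdone hAT hAm
        (fun ℓ i => if h : ℓ ∈ splittableLeaves t T then
          localGain G (labelled f xs) (B ⟨ℓ, h⟩) i else 0)
        ?_ ?_ ?_ hpA ?_
      · intro ℓ hℓ hlen i
        simp only [hAm ℓ hℓ hlen, dif_pos]
        exact hxs.abs_localGain_sub_le hC hα hH hn hb hτ0 hτ1 hτη (hpure.irredundant ℓ hℓ) hlen
          (hrep ⟨ℓ, _⟩) i
      · intro ℓ _ i
        split_ifs
        · exact localGain_le_one hI _ _ _
        · exact zero_le_one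
      · intro ℓ _ i hi
        split_ifs with h
        · exact (localGain_eq_zero_of_mem G _ (card_of_mem_batches (hrep ⟨ℓ, h⟩).1).1 hi).le
        · exact le_rfl
      · intro ℓ hℓ i
        simp only [hℓ, hpA, dif_pos]
        exact hmax ℓ hℓ i
    refine ⟨?_, key⟩
    have h1 := key.size_ne hI hm hη0
    rw [DecisionTree.size_split _ _ _ (hAT hpA)] at h1 ⊢
    omega

theorem toOuterMeasure_batchCompletion_le {f : Cube d → Bool} {e τ ζ : ℝ} {t b : ℕ} (hb : 0 < b)
    (hn : 0 < n) (hτ0 : 0 ≤ τ) (hτ1 : τ ≤ 1) {xs : Fin n → Cube d} (hxs : TreeAccurate f t ζ xs)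
    {T : PartialTree d} (hTt : T.size = t) (hT : CompletableTo f e T) :
    (batchCompletion b (labelled f xs) T).toOuterMeasure
      {U | ¬ (U.size = t ∧ treeError f U ≤ e + 2 * ζ + 2 * τ)} ≤
      ENNReal.ofReal (t * ((2 * d + 1) * 2 * (2 * Real.exp (-(b * τ ^ 2 / 4))))) := by
  rw [batchCompletion, PMF.toOuterMeasure_map_apply]
  have hdraw := toOuterMeasure_drawBatches_le (labelled f xs) b T.leaves
    (fun ℓ => {B | ¬ Representative (labelled f xs) b τ ℓ B}) (by positivity)
    fun ℓ _ => toOuterMeasure_not_representative_le (labelled f xs) hb ℓ hτ0 hτ1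
  rw [T.card_leaves, hTt] at hdraw
  refine (PMF.toOuterMeasure _).mono ?_ |>.trans hdraw
  intro B hB
  by_contra hnot
  have hrep : ∀ ℓ : {ℓ // ℓ ∈ T.leaves}, Representative (labelled f xs) b τ ℓ.1 (B ℓ) :=
    fun ℓ => by_contra fun h => hnot ⟨ℓ, h⟩
  apply hB
  refine ⟨(DecisionTree.size_complete _ _).trans hTt, ?_⟩
  obtain ⟨lab, hlab⟩ := hT
  have h1 := card_errors_complete_le f xs T B hrep lab
  have h2 := abs_le.1 (hxs (T.complete lab) ((DecisionTree.size_complete _ _).trans hTt))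
  have h3 := abs_le.1 (hxs (T.complete fun ℓ =>
      if h : ℓ ∈ T.leaves then decide (1 / 2 ≤ meanLabel (labelled f xs) (B ⟨ℓ, h⟩))
        else false) ((DecisionTree.size_complete _ _).trans hTt))
  have hn' : (0 : ℝ) < n := by exact_mod_cast hn
  have h4 : treeError f (T.complete lab) * n ≤ e * n := by gcongr
  refine le_of_mul_le_mul_right ?_ hn'
  linarith [h3.1, h2.2]

/-- The failure probability of the algorithm, in terms of the accuracies. -/
theorem toOuterMeasure_miniBatchTopDown_le {G : ℝ → ℝ} {κ C α ε : ℝ} (hd : 0 < d) (hκ : 0 < κ)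
    (hC : 0 < C) (hα : 0 < α) (hε : 0 < ε) (hI : IsImpurity G) (hG : IsStronglyConcave κ G)
    (hH : IsHolder C α G) {f : Cube d → Bool} (hf : IsMonotone f) {s : ℕ} (hs : 2 ≤ s) {m : ℕ}
    {η : ℝ} (hη : η = κ * ε ^ 2 / (8 * Real.logb 2 s ^ 2)) (hη0 : 0 < η)
    (hηm : (1 / 2) ^ m ≤ η / 4) (hm : 16 / 3 < η * m)
    {tie : PartialTree d → Finset (Leaf d × Fin d) → Leaf d × Fin d}
    (htie : ∀ T A, A.Nonempty → tie T A ∈ A) {t b : ℕ} (ht : 2 ≤ t) (hmt2 : 2 ^ m ≤ t)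
    (hmt : ((2 * m : ℕ) : ℝ) ≤ depthBound t) (hb : 0 < b) (hn : 0 < n) {τ ζ : ℝ} (hτ0 : 0 ≤ τ)
    (hτ1 : τ ≤ 1 / 16) (hτη : 2 * (C * (16 * τ) ^ α) ≤ η / 16) (hζ0 : 0 ≤ ζ) (hζ1 : ζ ≤ 1) :
    ((sampleDist f n).bind fun S => miniBatchTopDown G tie t b S).toOuterMeasure
      {U | ¬ (U.size = t ∧ treeError f U ≤ optError f s + ε / 2 + 2 * ζ + 2 * τ)} ≤
      ENNReal.ofReal
        ((2 * d + 1) ^ (2 * m + 1) * 2 *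
          (2 * Real.exp (-(n * ((1 / 2) ^ (2 * m) * τ / 4) ^ 2 / 4)))) +
      ENNReal.ofReal ((d + 2) ^ (2 * t - 1) * (2 * Real.exp (-(n * ζ ^ 2 / 4)))) +
      (t * ENNReal.ofReal (t * ((2 * d + 1) * 2 * (2 * Real.exp (-(b * τ ^ 2 / 4))))) +
        ENNReal.ofReal (t * ((2 * d + 1) * 2 * (2 * Real.exp (-(b * τ ^ 2 / 4)))))) := by
  have hpow : (1 / 2 : ℝ) ^ (2 * m) ≤ 1 := pow_le_one₀ (by norm_num) (by norm_num)
  rw [sampleDist, PMF.bind_map]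
  set bad := {xs : Fin n → Cube d | ¬ LeafAccurate f (2 * m + 1) ((1 / 2) ^ (2 * m) * τ / 4) xs} ∪
    {xs : Fin n → Cube d | ¬ TreeAccurate f t ζ xs}
  refine (PMF.toOuterMeasure_bind_le _ _ bad _
    (r := t * ENNReal.ofReal (t * ((2 * d + 1) * 2 * (2 * Real.exp (-(b * τ ^ 2 / 4))))) +
      ENNReal.ofReal (t * ((2 * d + 1) * 2 * (2 * Real.exp (-(b * τ ^ 2 / 4))))))
    fun xs hxs => ?_).trans ?_
  · simp only [bad, Set.mem_union, Set.mem_ofPred_eq, not_or, not_not] at hxs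
    change (miniBatchTopDown G tie t b (labelled f xs)).toOuterMeasure _ ≤ _
    rw [miniBatchTopDown]
    refine (PMF.toOuterMeasure_bind_le _ _
      {T | ¬ (T.size = t ∧ GrowInvariant G f (optError f s + ε / 2) η m T)} _
      (r := ENNReal.ofReal (t * ((2 * d + 1) * 2 * (2 * Real.exp (-(b * τ ^ 2 / 4))))))
      fun T hT => ?_).trans ?_
    · obtain ⟨hTt, hT⟩ := not_not.1 hT
      refine toOuterMeasure_batchCompletion_le hb hn hτ0 (by linarith) hxs.2 hTt
        (hT.resolve_right fun h => ?_)
      omega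
    · gcongr
      refine toOuterMeasure_growLoop_le G tie t b _ _ (fun T hT hTt =>
        toOuterMeasure_growStep_le hd hκ hC hα hε hI hG hH hf hs hη hη0 hηm hm htie ht hmt hb hn hτ0
          hτ1 hτη hxs.1 hT hTt) t _ (Or.inr ⟨?_, hasPurity_leaf hI f η⟩) ?_ ?_
      · refine Nat.one_lt_two_pow ?_
        rintro rfl
        simp at hm
        linarith
      · change 1 ≤ t; omega
      · omega
  · gcongr
    refine (MeasureTheory.measure_union_le (μ := PMF.toOuterMeasure _) _ _).trans ?_
    gcongr
    · exact toOuterMeasure_not_leafAccurate_le f _ n (by positivity) (by nlinarith)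
    · exact toOuterMeasure_not_treeAccurate_le f t n hζ0 hζ1

end

section

theorem IsStronglyConcave.kappa_le_two {G : ℝ → ℝ} {κ : ℝ} (hG : IsStronglyConcave κ G)
    (hI : IsImpurity G) : κ ≤ 2 := by
  have h := hG 0 ⟨le_rfl, zero_le_one⟩ 1 ⟨zero_le_one, le_rfl⟩
  have h2 := hI.map_half
  norm_num [hI.map_zero, hI.map_one] at h h2
  linarith

theorem IsImpurity.two_mul_le {G : ℝ → ℝ} (hI : IsImpurity G) {x : ℝ} (h0 : 0 ≤ x)
    (h1 : x ≤ 1 / 2) : 2 * x ≤ G x := by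
  have h := hI.concave.2 (show (0 : ℝ) ∈ Set.Icc 0 1 from ⟨le_rfl, zero_le_one⟩)
    (show (1 / 2 : ℝ) ∈ Set.Icc 0 1 from ⟨by norm_num, by norm_num⟩)
    (show 0 ≤ 1 - 2 * x by linarith) (show 0 ≤ 2 * x by linarith) (by ring)
  rw [hI.map_zero, hI.map_half] at h
  simp only [smul_eq_mul, mul_zero, zero_add, mul_one] at h
  rwa [show 2 * x * (1 / 2) = x by ring] at h

/-- No impurity function is Hölder with an exponent above one. -/
theorem IsHolder.alpha_le_one {G : ℝ → ℝ} {C α : ℝ} (hH : IsHolder C α G) (hI : IsImpurity G)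
    (hC : 0 < C) : α ≤ 1 := by
  by_contra! hα
  have hlim : Filter.Tendsto (fun x : ℝ => C * x ^ (α - 1)) (nhdsWithin 0 (Set.Ioi 0))
      (nhds (C * 0 ^ (α - 1))) := by
    refine Filter.Tendsto.const_mul _ (tendsto_nhdsWithin_of_tendsto_nhds ?_)
    exact (Real.continuousAt_rpow_const _ _ (Or.inr (by linarith))).tendsto
  rw [Real.zero_rpow (by linarith), mul_zero] at hlim
  have h1 := hlim.eventually (gt_mem_nhds (zero_lt_two' ℝ))
  have h2 : ∀ᶠ x : ℝ in nhdsWithin 0 (Set.Ioi 0), x < 1 / 2 :=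
    nhdsWithin_le_nhds (gt_mem_nhds (by norm_num))
  obtain ⟨x, ⟨hx1, hx2⟩, hx0⟩ := ((h1.and h2).and self_mem_nhdsWithin).exists
  have hx0 : 0 < x := hx0
  have h3 := hI.two_mul_le hx0.le hx2.le
  have h4 := hH x ⟨hx0.le, by linarith⟩ 0 ⟨le_rfl, zero_le_one⟩
  rw [hI.map_zero, sub_zero, sub_zero, abs_of_pos hx0] at h4
  have h5 : C * x ^ α = C * x ^ (α - 1) * x := by
    rw [Real.rpow_sub_one hx0.ne']
    field_simp
  have h6 := le_abs_self (G x)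
  nlinarith

theorem IsHolder.one_le {G : ℝ → ℝ} {C α : ℝ} (hH : IsHolder C α G) (hI : IsImpurity G)
    (hC : 0 < C) (hα : 0 < α) : 1 ≤ C := by
  have h := hH (1 / 2) ⟨by norm_num, by norm_num⟩ 0 ⟨le_rfl, zero_le_one⟩
  rw [hI.map_zero, hI.map_half, sub_zero, sub_zero, abs_one, abs_of_pos (by norm_num)] at h
  have : (1 / 2 : ℝ) ^ α ≤ 1 := Real.rpow_le_one (by norm_num) (by norm_num) hα.le
  nlinarith

/-- Comparison of the batch size with the accuracy needed for a Hölder function. -/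
theorem le_rpow_mul_rpow_sq {C X K α η γ : ℝ} (hC : 0 < C) (hα : 0 < α) (hα1 : α ≤ 1)
    (hη : η = 1 / (8 * X)) (hX : 0 < X) (hγ : γ = (η / (32 * C)) ^ (1 / α)) (hK : 65536 ≤ K) :
    K / 65536 ≤ K ^ (1 / α) * (C ^ 2 * X ^ 2) ^ (1 / α) * γ ^ 2 := by
  have h0 : 0 ≤ η / (32 * C) := by rw [hη]; positivity
  have e : K ^ (1 / α) * (C ^ 2 * X ^ 2) ^ (1 / α) * γ ^ 2 = (K / 65536) ^ (1 / α) := by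
    have e2 : ((η / (32 * C)) ^ (1 / α)) ^ 2 = ((η / (32 * C)) ^ 2) ^ (1 / α) := by
      rw [← Real.rpow_natCast, ← Real.rpow_mul h0, mul_comm (1 / α), Real.rpow_mul h0,
        Real.rpow_natCast]
    rw [hγ, e2, ← Real.mul_rpow (by linarith) (by positivity),
      ← Real.mul_rpow (mul_nonneg (by linarith) (by positivity)) (by positivity)]
    congr 1
    rw [hη]
    field_simp
    norm_num
  rw [e]
  refine Real.self_le_rpow_of_one_le ?_ ?_
  · rw [le_div_iff₀ (by norm_num)]; linarith
  · rw [le_div_iff₀ hα]; linarith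

/-- Exponentials of multiples of the logarithm are powers. -/
theorem exp_neg_mul_le_pow {y : ℝ} (hy : 1 ≤ y) (k : ℕ) {z : ℝ} (hz : k * Real.logb 2 y ≤ z) :
    Real.exp (-z) ≤ (1 / y) ^ k := by
  have hlog : Real.log y ≤ Real.logb 2 y := by
    unfold Real.logb
    rw [le_div_iff₀ (Real.log_pos (by norm_num))]
    have h0 := Real.log_nonneg hy
    have h1 : Real.log 2 ≤ 1 := by have := Real.log_two_lt_d9; linarith
    nlinarith
  have e : (1 / y) ^ k = Real.exp (-(k * Real.log y)) := by
    rw [Real.exp_neg, Real.exp_nat_mul, Real.exp_log (by linarith), one_div, inv_pow]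
  rw [e, Real.exp_le_exp]
  have : (k : ℝ) * Real.log y ≤ k * Real.logb 2 y := by gcongr
  linarith

theorem pow_mul_pow_le {D t δ : ℝ} {u d : ℝ} (hd : 1 ≤ d) (ht : 48 ≤ t) (hδ0 : 0 < δ) (hδ1 : δ ≤ 1)
    (hu0 : 0 ≤ u) (hu : u ≤ 3 * d) {k : ℕ} (hk : 1 ≤ k) (hD : D ≤ (1 / (t * d / δ)) ^ (k + 1)) :
    u ^ k * (4 * D) ≤ δ / 4 := by
  have hd0 : 0 < d := by linarith
  have ht0 : 0 < t := by linarith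
  have e : (1 : ℝ) / (t * d / δ) = δ / (t * d) := by field_simp
  rw [e] at hD
  have h1 : u * (δ / (t * d)) ≤ 1 / 16 := by
    rw [mul_div_assoc', div_le_iff₀ (by positivity)]
    nlinarith [mul_le_mul hu hδ1 hδ0.le (by positivity), mul_le_mul_of_nonneg_right ht hd0.le]
  have h2 : (u * (δ / (t * d))) ^ k ≤ 1 / 16 := by
    calc (u * (δ / (t * d))) ^ k ≤ (1 / 16) ^ k := pow_le_pow_left₀ (by positivity) h1 _
      _ ≤ (1 / 16) ^ 1 := pow_le_pow_of_le_one (by norm_num) (by norm_num) hk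
      _ = 1 / 16 := pow_one _
  have h3 : δ / (t * d) ≤ δ := div_le_self hδ0.le (by nlinarith)
  calc u ^ k * (4 * D) ≤ u ^ k * (4 * (δ / (t * d)) ^ (k + 1)) := by gcongr
    _ = 4 * ((u * (δ / (t * d))) ^ k * (δ / (t * d))) := by rw [pow_succ, mul_pow]; ring
    _ ≤ 4 * (1 / 16 * δ) := by gcongr
    _ = δ / 4 := by ring

/-- The failure probabilities of all the estimates add up to at most `δ`. -/
theorem failure_sum_le {d t n b m : ℕ} {A τ ε δ : ℝ} (hd1 : (1 : ℝ) ≤ d) (ht48 : (48 : ℝ) ≤ t)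
    (hδ : 0 < δ) (hδ2 : δ < 1 / 2) (hτ0 : 0 < τ) (hτε : τ ≤ ε / 8)
    (hAτ : 32 ≤ A * τ ^ 2) (hm1 : 1 ≤ m) (hm8 : 2 ^ (8 * m) ≤ t)
    (hmL : ((2 * m + 1 + 1 : ℕ) : ℝ) ≤ Real.logb 2 t)
    (hn : t * (A * Real.logb 2 (t * d / δ) * Real.logb 2 t) ≤ n)
    (hb : A * Real.logb 2 (t * d / δ) ≤ b) :
    (2 * d + 1) ^ (2 * m + 1) * 2 *
        (2 * Real.exp (-(n * ((1 / 2) ^ (2 * m) * τ / 4) ^ 2 / 4))) +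
      (d + 2) ^ (2 * t - 1) * (2 * Real.exp (-(n * (ε / 8) ^ 2 / 4))) +
      (t * (t * ((2 * d + 1) * 2 * (2 * Real.exp (-(b * τ ^ 2 / 4))))) +
        t * ((2 * d + 1) * 2 * (2 * Real.exp (-(b * τ ^ 2 / 4))))) ≤ δ := by
  have ht0 : (0 : ℝ) < t := by linarith
  have ht2 : 2 ≤ t := by
    have : (2 : ℝ) ≤ t := by linarith
    exact_mod_cast this
  have htd : (48 : ℝ) ≤ t * d := ht48.trans (le_mul_of_one_le_right ht0.le hd1)
  set y := t * d / δ with hy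
  have hy1 : 2 ≤ y := by
    rw [hy, le_div_iff₀ hδ]
    linarith
  set Λ := Real.logb 2 y with hΛ
  have hΛ1 : 1 ≤ Λ := by
    rw [hΛ, Real.le_logb_iff_rpow_le (by norm_num) (by linarith), Real.rpow_one]
    exact hy1
  have hΛ0 : 0 < Λ := by linarith
  set L := Real.logb 2 t with hL
  have hL1 : 1 ≤ L := logb_nonneg_of_two_le ht2
  have hL0 : 0 < L := by linarith
  have hbτ : (8 : ℕ) * Λ ≤ b * τ ^ 2 / 4 := by
    have h1 : A * Λ * τ ^ 2 ≤ b * τ ^ 2 := by gcongr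
    have h2 := mul_le_mul_of_nonneg_right hAτ hΛ0.le
    push_cast
    linarith
  have hnτ : 32 * (t * (Λ * L)) ≤ n * τ ^ 2 := by
    have h1 : t * (A * Λ * L) * τ ^ 2 ≤ n * τ ^ 2 := by gcongr
    have h2 := mul_le_mul_of_nonneg_right hAτ (by positivity : 0 ≤ t * (Λ * L))
    linarith
  have htΛ : t * Λ ≤ t * (Λ * L) := by
    rw [← mul_assoc]
    exact le_mul_of_one_le_right (by positivity) hL1
  have hnζ : ((2 * t - 1 + 1 : ℕ) : ℝ) * Λ ≤ n * (ε / 8) ^ 2 / 4 := by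
    have h1 : n * τ ^ 2 ≤ n * (ε / 8) ^ 2 := by gcongr
    have e : ((2 * t - 1 + 1 : ℕ) : ℝ) = 2 * t := by
      rw [Nat.sub_add_cancel (by omega)]; push_cast; ring
    rw [e]
    have : 0 < t * Λ := by positivity
    linarith
  have hnm : ((2 * m + 1 + 1 : ℕ) : ℝ) * Λ ≤ n * ((1 / 2) ^ (2 * m) * τ / 4) ^ 2 / 4 := by
    have e : n * ((1 / 2) ^ (2 * m) * τ / 4) ^ 2 / 4 = n * τ ^ 2 / (64 * 2 ^ (4 * m)) := by
      rw [div_pow, mul_pow, ← pow_mul, show 2 * m * 2 = 4 * m by ring, div_pow, one_pow]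
      field_simp
      norm_num
    rw [e, le_div_iff₀ (by positivity)]
    refine le_trans ?_ hnτ
    have h1 : (2 : ℝ) ^ (4 * m) * 2 ^ (4 * m) ≤ t := by
      rw [← pow_add, show 4 * m + 4 * m = 8 * m by ring]
      exact_mod_cast hm8
    have h2 : (2 : ℝ) ≤ 2 ^ (4 * m) := by
      calc (2 : ℝ) = 2 ^ 1 := by norm_num
        _ ≤ 2 ^ (4 * m) := pow_le_pow_right₀ (by norm_num) (by omega)
    have h4 : 2 * (2 : ℝ) ^ (4 * m) ≤ t := by
      refine le_trans ?_ h1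
      gcongr
    calc ((2 * m + 1 + 1 : ℕ) : ℝ) * Λ * (64 * 2 ^ (4 * m))
        ≤ L * Λ * (64 * 2 ^ (4 * m)) := by gcongr
      _ = 32 * ((2 * 2 ^ (4 * m)) * (Λ * L)) := by ring
      _ ≤ 32 * (t * (Λ * L)) := by gcongr
  have hE1 := exp_neg_mul_le_pow (by linarith : 1 ≤ y) _ hnm
  have hE2 := exp_neg_mul_le_pow (by linarith : 1 ≤ y) _ hnζ
  have hE3 := exp_neg_mul_le_pow (by linarith : 1 ≤ y) _ hbτ
  have hF1 := pow_mul_pow_le (u := 2 * d + 1) hd1 ht48 hδ (by linarith) (by positivity)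
    (by linarith) (by omega) hE1
  have hF2 := pow_mul_pow_le (u := d + 2) hd1 ht48 hδ (by linarith) (by positivity)
    (by linarith) (by omega) hE2
  set E3 := Real.exp (-(b * τ ^ 2 / 4))
  have hE30 : 0 < E3 := Real.exp_pos _
  have hF3 : (t * t + t) * ((2 * d + 1) * 2 * (2 * E3)) ≤ δ / 2 := by
    have e : (1 : ℝ) / y = δ / (t * d) := by rw [hy]; field_simp
    have hq0 : 0 ≤ δ / (t * d) := by positivity
    have hq1 : δ / (t * d) ≤ 1 := by
      rw [div_le_one (by positivity)]
      linarith
    have h1 : E3 ≤ (δ / (t * d)) ^ 3 := by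
      refine hE3.trans ?_
      rw [e]
      exact pow_le_pow_of_le_one hq0 hq1 (by norm_num)
    have h2 : (t * t + t) * ((2 * d + 1) * 2 * (2 * E3)) ≤
        (2 * (t * t)) * ((3 * d) * 2 * (2 * (δ / (t * d)) ^ 3)) := by
      have h3 : (t : ℝ) ≤ t * t := le_mul_of_one_le_right ht0.le (by linarith)
      gcongr <;> linarith
    refine h2.trans ?_
    have h3 : (2 * ((t : ℝ) * t)) * ((3 * d) * 2 * (2 * (δ / (t * d)) ^ 3)) =
        24 * δ ^ 3 / (t * (d * d)) := by
      field_simp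
      ring
    rw [h3, div_le_iff₀ (by positivity)]
    have h4 : δ ^ 3 ≤ δ := pow_le_of_le_one hδ.le (by linarith) (by norm_num)
    have h5 : (48 : ℝ) ≤ t * (d * d) :=
      ht48.trans (le_mul_of_one_le_right ht0.le (one_le_mul_of_one_le_of_one_le hd1 hd1))
    have h6 : δ / 2 * 48 ≤ δ / 2 * (t * (d * d)) := by gcongr
    linarith
  have hpos : 0 ≤ ((d : ℝ) + 2) ^ (2 * t - 1) * (2 * Real.exp (-(n * (ε / 8) ^ 2 / 4))) := by
    positivity
  linarith

end

theorem theorem4 :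
    ∃ c K : ℝ, 0 < c ∧ 0 < K ∧
      ∀ (d : ℕ) (f : Cube d → Bool) (G : ℝ → ℝ) (κ C α : ℝ),
        0 < d → IsMonotone f →
        IsImpurity G → 0 < κ → 0 < C → 0 < α → IsStronglyConcave κ G → IsHolder C α G →
      ∀ tie : PartialTree d → Finset (Leaf d × Fin d) → Leaf d × Fin d,
        (∀ T A, A.Nonempty → tie T A ∈ A) →
      ∀ (s : ℕ) (ε δ : ℝ), 2 ≤ s → 0 < ε → ε < 1 / 2 → 0 < δ → δ < 1 / 2 →
      ∀ t n b : ℕ,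
        (s : ℝ) ^ (c * Real.logb 2 s / (κ * ε ^ 2)) ≤ t →
        (t : ℝ) * (K ^ (1 / α) * (C ^ 2 * Real.logb 2 s ^ 4 / (κ ^ 2 * ε ^ 4)) ^ (1 / α) *
            Real.logb 2 (t * d / δ) * Real.logb 2 t) ≤ n →
        K ^ (1 / α) * (C ^ 2 * Real.logb 2 s ^ 4 / (κ ^ 2 * ε ^ 4)) ^ (1 / α) *
            Real.logb 2 (t * d / δ) ≤ b →
        ENNReal.ofReal (1 - δ) ≤
          ((sampleDist f n).bind fun S => miniBatchTopDown G tie t b S).toOuterMeasure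
            {T : DecisionTree d Bool | T.size = t ∧ treeError f T ≤ optError f s + ε} := by
  refine ⟨1024, 2 ^ 29, by norm_num, by norm_num, ?_⟩
  intro d f G κ C α hd hf hI hκ hC hα hG hH tie htie s ε δ hs hε hε2 hδ hδ2 t n b ht hn hb
  have hα1 := hH.alpha_le_one hI hC
  have hC1 := hH.one_le hI hC hα
  have hκ2 := hG.kappa_le_two hI
  have hs0 : (0 : ℝ) < s := by exact_mod_cast (by omega : 0 < s)
  have hlogs := logb_nonneg_of_two_le hs
  set l := Real.logb 2 s with hl
  have hl0 : 0 < l := by linarith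
  set X := l ^ 2 / (κ * ε ^ 2) with hX
  have hX0 : 0 < X := by positivity
  have hX2 : 2 ≤ X := by
    rw [hX, le_div_iff₀ (by positivity)]
    nlinarith [mul_le_mul hκ2 (show ε ^ 2 ≤ 1 / 4 by nlinarith) (by positivity) zero_le_two]
  set η := κ * ε ^ 2 / (8 * l ^ 2) with hη
  have hη0 : 0 < η := by positivity
  have hηX : η = 1 / (8 * X) := by rw [hη, hX]; field_simp
  have hηε : η ≤ ε / 8 := by
    rw [hη, div_le_iff₀ (by positivity)]
    have h1 : κ * ε ^ 2 ≤ ε := by nlinarith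
    nlinarith [mul_le_mul_of_nonneg_left (show 1 ≤ l ^ 2 by nlinarith) hε.le]
  have hXe : C ^ 2 * l ^ 4 / (κ ^ 2 * ε ^ 4) = C ^ 2 * X ^ 2 := by rw [hX]; field_simp
  rw [hXe] at hn hb
  set γ := (η / (32 * C)) ^ (1 / α) with hγ
  set τ := γ / 16 with hτ
  have hbase0 : 0 < η / (32 * C) := by positivity
  have hbase : η / (32 * C) ≤ η / 32 := by
    apply div_le_div_of_nonneg_left hη0.le (by norm_num); linarith
  have hγη : γ ≤ η / 32 := by
    refine le_trans ?_ hbase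
    have := Real.rpow_le_rpow_of_exponent_ge hbase0 (by linarith)
      (show 1 ≤ 1 / α by rw [le_div_iff₀ hα]; linarith)
    rwa [Real.rpow_one] at this
  have hγ0 : 0 < γ := by positivity
  have hτ0 : 0 < τ := by positivity
  have hτε : τ ≤ ε / 8 := by rw [hτ]; linarith
  have hτη : 2 * (C * (16 * τ) ^ α) ≤ η / 16 := by
    rw [show 16 * τ = γ by rw [hτ]; ring, hγ, ← Real.rpow_mul hbase0.le, one_div_mul_cancel hα.ne',
      Real.rpow_one]
    apply le_of_eq
    field_simp
    norm_num
  set A := ((2 : ℝ) ^ 29) ^ (1 / α) * (C ^ 2 * X ^ 2) ^ (1 / α) with hA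
  have hA0 : 0 < A := by positivity
  have hAτ : 32 ≤ A * τ ^ 2 := by
    have := le_rpow_mul_rpow_sq (K := 2 ^ 29) hC hα hα1 hηX hX0 hγ (by norm_num)
    rw [hτ, div_pow, mul_div_assoc', le_div_iff₀ (by norm_num)]
    refine le_trans ?_ this
    norm_num
  have ht0 : (0 : ℝ) < t := lt_of_lt_of_le (Real.rpow_pos_of_pos hs0 _) ht
  have htX : 1024 * X ≤ Real.logb 2 t := by
    have := Real.logb_le_logb_of_le (b := 2) (by norm_num) (Real.rpow_pos_of_pos hs0 _) ht
    rw [Real.logb_rpow_eq_mul_logb_of_pos hs0] at this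
    refine le_trans (le_of_eq ?_) this
    rw [hX, ← hl]
    ring
  have htne : t ≠ 0 := by rintro rfl; simp at ht0
  set m := Nat.log 2 t / 8 with hm
  have hm8 : 2 ^ (8 * m) ≤ t :=
    (Nat.pow_le_pow_right (by norm_num) (by omega)).trans (Nat.pow_log_le_self 2 htne)
  have hmlog : (8 * m : ℝ) ≤ Real.logb 2 t := by
    rw [Real.le_logb_iff_rpow_le (by norm_num) ht0]
    have : (2 : ℝ) ^ (8 * m) ≤ t := by exact_mod_cast hm8
    rwa [← Real.rpow_natCast, Nat.cast_mul] at this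
  have hmX : 127 * X ≤ m := by
    have h1 : t < 2 ^ (8 * m + 8) := by
      refine (Nat.lt_pow_succ_log_self (b := 2) (by norm_num) t).trans_le ?_
      exact Nat.pow_le_pow_right (by norm_num) (by omega)
    have h2 : Real.logb 2 t ≤ (8 * m + 8 : ℕ) := by
      rw [Real.logb_le_iff_le_rpow (by norm_num) ht0, Real.rpow_natCast]
      exact_mod_cast h1.le
    push_cast at h2
    linarith
  have hm254 : (254 : ℝ) ≤ m := by linarith
  have hm1 : 1 ≤ m := by
    have : (1 : ℝ) ≤ m := by linarith
    exact_mod_cast this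
  have hηm : 16 / 3 < η * m := by
    rw [hηX, one_div_mul_eq_div, lt_div_iff₀ (by positivity)]
    linarith
  have h2m : (m : ℝ) < 2 ^ m := by exact_mod_cast Nat.lt_two_pow_self
  have hpm : (1 / 2 : ℝ) ^ m ≤ η / 4 := by
    rw [hηX, div_pow, one_pow, div_div]
    apply one_div_le_one_div_of_le (by positivity)
    linarith
  have ht48 : (48 : ℝ) ≤ t := by
    have h1 : 2 ^ m ≤ t := (Nat.pow_le_pow_right (by norm_num) (by omega)).trans hm8
    have h2 : (2 : ℝ) ^ m ≤ t := by exact_mod_cast h1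
    linarith
  have ht2 : 2 ≤ t := by
    have : (2 : ℝ) ≤ t := by linarith
    exact_mod_cast this
  have hmt2 : 2 ^ m ≤ t := (Nat.pow_le_pow_right (by norm_num) (by omega)).trans hm8
  have hmt : ((2 * m : ℕ) : ℝ) ≤ depthBound t := by
    refine le_trans ?_ (logb_le_depthBound ht2)
    push_cast
    linarith
  have hd1 : (1 : ℝ) ≤ d := by exact_mod_cast hd
  have hΛ0 : 0 < Real.logb 2 (t * d / δ) := by
    refine Real.logb_pos (by norm_num) ?_
    rw [lt_div_iff₀ hδ]
    have := ht48.trans (le_mul_of_one_le_right ht0.le hd1)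
    linarith
  have hL0 : 0 < Real.logb 2 t := by linarith
  have hbpos : 0 < b := Nat.cast_pos.1 (lt_of_lt_of_le (mul_pos hA0 hΛ0) hb)
  have hnpos : 0 < n := Nat.cast_pos.1 (lt_of_lt_of_le (by positivity) hn)
  have main := toOuterMeasure_miniBatchTopDown_le hd hκ hC hα hε hI hG hH hf hs hη hη0 hpm hηm htie
    ht2 hmt2 hmt hbpos hnpos hτ0.le (by linarith) hτη (ζ := ε / 8) (by linarith) (by linarith)
  have hsum : ((sampleDist f n).bind fun S => miniBatchTopDown G tie t b S).toOuterMeasure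
      {T : DecisionTree d Bool | T.size = t ∧ treeError f T ≤ optError f s + ε}ᶜ ≤
      ENNReal.ofReal δ := by
    refine (((sampleDist f n).bind fun S => miniBatchTopDown G tie t b S).toOuterMeasure.mono
      ?_).trans (main.trans ?_)
    · intro U hU hU'
      exact hU ⟨hU'.1, hU'.2.trans (by linarith)⟩
    · rw [← ENNReal.ofReal_natCast, ← ENNReal.ofReal_mul (by positivity),
        ← ENNReal.ofReal_add (by positivity) (by positivity),
        ← ENNReal.ofReal_add (by positivity) (by positivity),
        ← ENNReal.ofReal_add (by positivity) (by positivity)]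
      apply ENNReal.ofReal_le_ofReal
      exact failure_sum_le hd1 ht48 hδ hδ2 hτ0 hτε hAτ hm1 hm8 (by push_cast; linarith) hn hb
  set p := (sampleDist f n).bind fun S => miniBatchTopDown G tie t b S
  have hone : 1 ≤ p.toOuterMeasure
      {T : DecisionTree d Bool | T.size = t ∧ treeError f T ≤ optError f s + ε} +
      ENNReal.ofReal δ := by
    rw [← p.toOuterMeasure_univ,
      ← Set.union_compl_self {T : DecisionTree d Bool | T.size = t ∧ treeError f T ≤ optError f s + ε}]
    refine (MeasureTheory.measure_union_le (μ := p.toOuterMeasure) _ _).trans ?_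
    gcongr
  rw [ENNReal.ofReal_sub _ hδ.le, ENNReal.ofReal_one]
  exact tsub_le_iff_right.2 hone
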